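/- For every natural number $k\equiv 4 \pmod 5$ the numbers \[ n=\frac{512k^5+1280k^4+6400k^3+8640k^2+6890k+757}{3125},\qquad g_2=\frac{32k^3+56k^2+316k+167}{125},\] \[ g_3=\frac{128k^4+192k^3+1408k^2+1002k+908}{625},\qquad g_4=\frac{128k^4+352k^3+1488k^2+2432k+543}{625},\] \[ g_5=\frac{256k^4+384k^3+2616k^2+1354k+116}{625}\] are positive integers, and the undirected Cayley graph of the cyclic group $\mathbb{Z}/n\mathbb{Z}$ with the generating set $\{1,g_2,g_3,g_4,g_5\}$ (vertices $u,v$ are adjacent if and only if $u-v\equiv\pm g \pmod n$ for some $g$ in this set), whose five elements are pairwise distinct modulo $n$, is a circulant graph of order $n$, regular of degree $10$, and has diameter exactly $k$. -/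

import Mathlib

/-! Write k = 5a + 4. The group being abelian, a residue has word length at most d exactly when it
equals ∑ yᵢ gᵢ for an integer vector y of ℓ¹ norm at most d. Two vectors give the same residue
exactly when they differ by an element of the lattice L of relations, that is, of vectors z with n ∣
∑ zᵢ gᵢ. So the diameter is the covering radius of L in ℤ⁵ for the ℓ¹ metric. The lattice has an
explicit basis with entries linear in a (`sum_relationVec_mul_circGen`, `exists_eq_relationVec`),
and everything else is ℓ¹ geometry of this basis.

Upper bound: it suffices that every x of norm exactly 5a + 5 becomes shorter after subtracting some
element of L (`exists_relationVec_near`), since then the balls stop growing at radius 5a + 4.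
Reflections reduce this to nonnegative vectors, one orthant at a time. A decision tree cuts the
simplex ∑ uᵢ = 5a + 5 into boxes with bounds affine in a, each either missing the simplex or having
one short relation that works on all of its intersection with the simplex. The inequalities involved
are affine in t = a − 2, and nonnegative coefficients prove them for all t ≥ 0 at once, so one
finite check serves every a ≥ 2.

Lower bound: the vector (a+1, a+1, a+1, a+1, a) has distance at least 5a + 4 from L
(`le_dist_centerVec`). Near-diagonality of the basis makes all but finitely many relations too long
to be closer, and the others are checked as affine forms.

The cases a = 0, 1 are settled by computing the balls in ℤ/n. -/

/-- The elements of an additive group of word length at most `d` with respect to `S ∪ -S`. -/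
def wordBall {A : Type*} [AddCommGroup A] (S : Set A) : ℕ → Set A
  | 0 => {0}
  | d + 1 => {x | x ∈ wordBall S d ∨ ∃ s, (s ∈ S ∨ -s ∈ S) ∧ x - s ∈ wordBall S d}

/-! ### Balls, distances and diameter in circulant graphs -/

section WordBall

variable {A : Type*} [AddCommGroup A] {S : Set A}

theorem wordBall_subset_succ (d : ℕ) : wordBall S d ⊆ wordBall S (d + 1) :=
  fun _ hx => Or.inl hx

theorem wordBall_mono {d e : ℕ} (h : d ≤ e) : wordBall S d ⊆ wordBall S e := by
  induction h with
  | refl => exact subset_rfl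
  | step _ ih => exact ih.trans (wordBall_subset_succ _)

theorem zero_mem_wordBall (d : ℕ) : (0 : A) ∈ wordBall S d :=
  wordBall_mono (Nat.zero_le d) rfl

theorem add_mem_wordBall {d : ℕ} {x s : A} (hx : x ∈ wordBall S d) (hs : s ∈ S ∨ -s ∈ S) :
    x + s ∈ wordBall S (d + 1) :=
  Or.inr ⟨s, hs, by simpa using hx⟩

/-- A step out of the ball of radius d lands in the ball of radius d + 1, hence back in the former:
once the balls stop growing they never resume. -/
theorem wordBall_subset_of_succ_subset {d : ℕ} (h : wordBall S (d + 1) ⊆ wordBall S d) (m : ℕ) :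
    wordBall S m ⊆ wordBall S d := by
  induction m with
  | zero => exact wordBall_mono (Nat.zero_le d)
  | succ m ih =>
    rintro x (hx | ⟨s, hs, hx⟩)
    · exact ih hx
    · exact h (Or.inr ⟨s, hs, ih hx⟩)

theorem natCast_mem_wordBall {n : ℕ} {S : Set (ZMod n)} (h : 1 ∈ S) (m : ℕ) :
    (m : ZMod n) ∈ wordBall S m := by
  induction m with
  | zero => simp [wordBall]
  | succ m ih =>
    rw [Nat.cast_succ]
    exact add_mem_wordBall ih (Or.inl h)

theorem sub_mem_wordBall_of_walk {u v : A} (p : (SimpleGraph.circulantGraph S).Walk u v) :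
    v - u ∈ wordBall S p.length := by
  induction p with
  | nil => simp [wordBall]
  | @cons u v w h p ih =>
    have hs : v - u ∈ S ∨ -(v - u) ∈ S := by
      rw [SimpleGraph.circulantGraph_adj] at h
      rw [neg_sub]
      exact h.2.symm
    have := add_mem_wordBall ih hs
    rwa [sub_add_sub_cancel] at this

theorem edist_le_of_mem_wordBall {d : ℕ} {u v : A} (h : v - u ∈ wordBall S d) :
    (SimpleGraph.circulantGraph S).edist u v ≤ d := by
  induction d generalizing v with
  | zero =>
    have : v = u := sub_eq_zero.mp h
    simp [this]
  | succ d ih =>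
    rcases h with h | ⟨s, hs, h⟩
    · exact (ih h).trans (by exact_mod_cast Nat.le_succ d)
    · have h1 : (SimpleGraph.circulantGraph S).edist u (v - s) ≤ d :=
        ih (by rwa [sub_right_comm])
      have h2 : (SimpleGraph.circulantGraph S).edist (v - s) v ≤ 1 := by
        rw [SimpleGraph.edist_le_one_iff_adj_or_eq, SimpleGraph.circulantGraph_adj]
        -- The graph has no loops, so a step by s = 0 is not an edge; there the two vertices
        -- coincide.
        by_cases hv : v - s = v
        · exact Or.inr hv
        · refine Or.inl ⟨hv, ?_⟩
          simpa [or_comm] using hs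
      refine SimpleGraph.edist_triangle.trans ((add_le_add h1 h2).trans ?_)
      push_cast
      exact le_rfl

theorem edist_circulantGraph_le_iff {d : ℕ} {u v : A} :
    (SimpleGraph.circulantGraph S).edist u v ≤ d ↔ v - u ∈ wordBall S d := by
  refine ⟨fun h => ?_, edist_le_of_mem_wordBall⟩
  obtain ⟨p, hp⟩ := SimpleGraph.exists_walk_of_edist_ne_top
    (ne_top_of_le_ne_top (ENat.natCast_ne_top d) h)
  refine wordBall_mono ?_ (sub_mem_wordBall_of_walk p)
  rw [← hp] at h
  exact_mod_cast h

/-- The diameter of a circulant graph is read off from the balls around `0`. -/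
theorem ediam_circulantGraph_eq {d : ℕ} (h : ∀ x, x ∈ wordBall S (d + 1))
    (h' : ∃ x, x ∉ wordBall S d) :
    (SimpleGraph.circulantGraph S).ediam = (d + 1 : ℕ) := by
  apply le_antisymm
  · exact SimpleGraph.ediam_le_of_edist_le fun u v => edist_circulantGraph_le_iff.2 (h _)
  · obtain ⟨x, hx⟩ := h'
    refine le_trans ?_ (SimpleGraph.edist_le_ediam (u := (0 : A)) (v := x))
    by_contra hlt
    have hlt := not_le.1 hlt
    rw [Nat.cast_succ, ENat.lt_natCast_add_one_iff, edist_circulantGraph_le_iff, sub_zero] at hlt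
    exact hx hlt

/-- By commutativity only the signed multiplicity of each generator matters. This replaces word
length by the ℓ¹ norm on ℤ^ι. -/
theorem mem_wordBall_range_iff {ι : Type*} [Fintype ι] [DecidableEq ι] (γ : ι → A) (d : ℕ)
    (x : A) :
    x ∈ wordBall (Set.range γ) d ↔
      ∃ y : ι → ℤ, ∑ i, |y i| ≤ d ∧ ∑ i, y i • γ i = x := by
  constructor
  · intro h
    induction d generalizing x with
    | zero => exact ⟨0, by simp, by simpa using (show x = 0 from h).symm⟩
    | succ d ih =>
      rcases h with h | ⟨s, hs, h⟩
      · obtain ⟨y, hy, rfl⟩ := ih x h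
        exact ⟨y, by push_cast; omega, rfl⟩
      · obtain ⟨y, hy, hx⟩ := ih _ h
        obtain ⟨ε, i, hε, rfl⟩ : ∃ (ε : ℤ) (i : ι), |ε| ≤ 1 ∧ s = ε • γ i := by
          rcases hs with ⟨i, hi⟩ | ⟨i, hi⟩
          · exact ⟨1, i, by simp, by rw [hi, one_smul]⟩
          · exact ⟨-1, i, by simp, by rw [hi, neg_smul, one_smul, neg_neg]⟩
        refine ⟨y + Pi.single i ε, ?_, ?_⟩
        · have h1 : ∑ j, |(y + (Pi.single i ε : ι → ℤ)) j| ≤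
              ∑ j, (|y j| + (Pi.single i |ε| : ι → ℤ) j) := by
            refine Finset.sum_le_sum fun j _ => (abs_add_le _ _).trans (le_of_eq ?_)
            congr 1
            by_cases hj : j = i
            · subst hj
              simp
            · simp [hj]
          rw [Finset.sum_add_distrib, Finset.sum_pi_single' i |ε|, if_pos (Finset.mem_univ i)] at h1
          push_cast
          linarith
        · simp only [Pi.add_apply, add_smul, Finset.sum_add_distrib, hx]
          rw [Finset.sum_eq_single i (fun j _ hj => by simp [hj]) (by simp)]
          simp
  · rintro ⟨y, hy, rfl⟩
    induction d generalizing y with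
    | zero =>
      have h0 : ∀ i, y i = 0 := fun i => by
        have : |y i| ≤ ∑ j, |y j| :=
          Finset.single_le_sum (f := fun j => |y j|) (fun j _ => abs_nonneg _) (Finset.mem_univ i)
        exact abs_eq_zero.1 (le_antisymm (by push_cast at hy; omega) (abs_nonneg _))
      simp [h0, wordBall]
    | succ d ih =>
      by_cases h0 : ∀ i, y i = 0
      · simp only [h0, zero_smul, Finset.sum_const_zero]
        exact zero_mem_wordBall _
      · push Not at h0
        obtain ⟨i, hi⟩ := h0
        -- Moving one nonzero coordinate a unit towards 0 lowers the norm by exactly 1 and removes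
        -- one letter of the word.
        set ε : ℤ := (y i).sign with hε
        have hz := ih (y - Pi.single i ε) (by
          have h1 : ∀ j, |(y - (Pi.single i ε : ι → ℤ)) j| = |y j| - (Pi.single i 1 : ι → ℤ) j := by
            intro j
            by_cases hj : j = i
            · subst hj
              rcases lt_or_gt_of_ne hi with h | h
              · simp only [Pi.sub_apply, Pi.single_eq_same, hε, Int.sign_eq_neg_one_of_neg h]
                rw [abs_of_nonpos (by omega), abs_of_neg h]; omega
              · simp only [Pi.sub_apply, Pi.single_eq_same, hε, Int.sign_eq_one_of_pos h]
                rw [abs_of_nonneg (by omega), abs_of_pos h]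
            · simp [hj]
          simp only [h1, Finset.sum_sub_distrib]
          push_cast at hy
          simp only [Finset.sum_pi_single', Finset.mem_univ, if_true]
          omega)
        have hs : ε • γ i ∈ Set.range γ ∨ -(ε • γ i) ∈ Set.range γ := by
          rcases lt_or_gt_of_ne hi with h | h
          · exact Or.inr ⟨i, by simp [hε, Int.sign_eq_neg_one_of_neg h]⟩
          · exact Or.inl ⟨i, by simp [hε, Int.sign_eq_one_of_pos h]⟩
        have := add_mem_wordBall hz hs
        convert this using 1
        simp only [Pi.sub_apply, sub_smul, Finset.sum_sub_distrib]
        rw [Finset.sum_eq_single (M := A) (f := fun j => (Pi.single i ε : ι → ℤ) j • γ j) i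
          (fun j _ hj => by simp [hj]) (by simp)]
        simp

end WordBall

/-! ### Computing balls in ℤ/n with bit vectors -/

/-- Bit vectors of length `n`: cyclic shift by `g`. -/
def rotateBits (n b g : ℕ) : ℕ := ((b <<< g) % 2 ^ n) ||| (b >>> (n - g))

/-- The two alternatives are the unwrapped and the wrapped part of the shift. The bound `hb` keeps
the wrapped part below n. -/
theorem testBit_rotateBits {n b g r : ℕ} (hb : ∀ i, b.testBit i = true → i < n) (hg : g ≤ n) :
    (rotateBits n b g).testBit r = true ↔
      r < n ∧ ((g ≤ r ∧ b.testBit (r - g) = true) ∨ b.testBit (r + n - g) = true) := by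
  simp only [rotateBits, Nat.testBit_or, Nat.testBit_mod_two_pow, Nat.testBit_shiftLeft,
    Nat.testBit_shiftRight, Bool.or_eq_true, Bool.and_eq_true, decide_eq_true_eq]
  have e : n - g + r = r + n - g := by omega
  rw [e]
  constructor
  · rintro (h | h)
    · exact ⟨h.1, Or.inl ⟨h.2.1, h.2.2⟩⟩
    · have := hb _ h
      exact ⟨by omega, Or.inr h⟩
  · rintro ⟨h, h' | h'⟩
    · exact Or.inl ⟨h, h'.1, h'.2⟩
    · exact Or.inr h'

/-- The union of a bit vector with its cyclic shifts by the elements of `l`. The case distinction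
forces the evaluation of `b` before it is duplicated. -/
def expandBits (n : ℕ) (l : List ℕ) (b : ℕ) : ℕ :=
  Nat.casesOn b 0 fun m => l.foldr (fun g acc => acc ||| rotateBits n (m + 1) g) (m + 1)

/-- Bit `r` is set iff `r` has word length at most `d` in `ZMod n`, for the generators `l`. -/
def ballBits (n : ℕ) (l : List ℕ) : ℕ → ℕ
  | 0 => 1
  | d + 1 => expandBits n l (ballBits n l d)

theorem testBit_foldr_or {α : Type*} (l : List α) (f : α → ℕ) (b r : ℕ) :
    (l.foldr (fun g acc => acc ||| f g) b).testBit r = true ↔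
      b.testBit r = true ∨ ∃ g ∈ l, (f g).testBit r = true := by
  induction l with
  | nil => simp
  | cons g l ih =>
    simp only [List.foldr_cons, Nat.testBit_or, Bool.or_eq_true, ih, List.mem_cons,
      exists_eq_or_imp]
    rw [or_assoc, or_comm (a := ∃ g ∈ l, _)]

theorem testBit_expandBits (n : ℕ) (l : List ℕ) (b r : ℕ) :
    (expandBits n l b).testBit r = true ↔
      b.testBit r = true ∨ ∃ g ∈ l, (rotateBits n b g).testBit r = true := by
  cases b with
  | zero => simp [expandBits, rotateBits]
  | succ m => exact testBit_foldr_or l _ _ r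

theorem testBit_ballBits {n : ℕ} (hn : 0 < n) {l : List ℕ} (hl : ∀ g ∈ l, g ≤ n)
    {S : Set (ZMod n)} (hS : ∀ s : ZMod n, (s ∈ S ∨ -s ∈ S) ↔ ∃ g ∈ l, (g : ZMod n) = s)
    (d r : ℕ) :
    (ballBits n l d).testBit r = true ↔ r < n ∧ (r : ZMod n) ∈ wordBall S d := by
  induction d generalizing r with
  | zero =>
    simp only [ballBits, Nat.testBit_one_eq_true_iff_self_eq_zero, wordBall, Set.mem_singleton_iff,
      ZMod.natCast_eq_zero_iff]
    constructor
    · rintro rfl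
      simp [hn]
    · rintro ⟨h, h'⟩
      exact Nat.eq_zero_of_dvd_of_lt h' h
  | succ d ih =>
    have hb : ∀ i, (ballBits n l d).testBit i = true → i < n := fun i h => ((ih i).1 h).1
    simp only [ballBits, testBit_expandBits, ih r]
    constructor
    · rintro (h | ⟨g, hg, h⟩)
      · exact ⟨h.1, Or.inl h.2⟩
      · rw [testBit_rotateBits hb (hl g hg)] at h
        refine ⟨h.1, Or.inr ⟨g, (hS _).2 ⟨g, hg, rfl⟩, ?_⟩⟩
        rcases h.2 with h | h
        · have := ((ih _).1 h.2).2
          rwa [Nat.cast_sub h.1] at this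
        · have := ((ih _).1 h).2
          have hgn := hl g hg
          rwa [Nat.cast_sub (by omega), Nat.cast_add, ZMod.natCast_self, add_zero] at this
    · rintro ⟨hr, h | ⟨s, hs, h⟩⟩
      · exact Or.inl ⟨hr, h⟩
      · obtain ⟨g, hg, rfl⟩ := (hS s).1 hs
        refine Or.inr ⟨g, hg, ?_⟩
        have hgn := hl g hg
        rw [testBit_rotateBits hb hgn]
        refine ⟨hr, ?_⟩
        by_cases hgr : g ≤ r
        · exact Or.inl ⟨hgr, (ih _).2 ⟨by omega, by rwa [Nat.cast_sub hgr]⟩⟩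
        · refine Or.inr ((ih _).2 ⟨by omega, ?_⟩)
          rwa [Nat.cast_sub (by omega), Nat.cast_add, ZMod.natCast_self, add_zero]

/-- The diameter of a circulant graph from a computation with bit vectors. -/
theorem ediam_eq_of_ballBits {n : ℕ} (hn : 0 < n) {l : List ℕ} (hl : ∀ g ∈ l, g ≤ n)
    {S : Set (ZMod n)} (hS : ∀ s : ZMod n, (s ∈ S ∨ -s ∈ S) ↔ ∃ g ∈ l, (g : ZMod n) = s) {d : ℕ}
    (h : ballBits n l (d + 1) = 2 ^ n - 1) (h' : ballBits n l d ≠ 2 ^ n - 1) :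
    (SimpleGraph.circulantGraph S).ediam = (d + 1 : ℕ) := by
  have : NeZero n := ⟨hn.ne'⟩
  apply ediam_circulantGraph_eq
  · intro x
    have := (testBit_ballBits hn hl hS (d + 1) x.val).1 (by
      rw [h, Nat.testBit_two_pow_sub_one]
      simpa using x.val_lt)
    simpa using this.2
  · by_contra hc
    push Not at hc
    apply h'
    apply Nat.eq_of_testBit_eq
    intro i
    rw [Nat.testBit_two_pow_sub_one, Bool.eq_iff_iff, testBit_ballBits hn hl hS]
    simpa using fun _ => hc _

/-! ### Inequalities between affine forms, uniform in t ≥ 0 -/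

/-- The affine form `c + b * t` in a parameter `t ≥ 0`. -/
structure AffineForm where
  c : ℤ
  b : ℤ

namespace AffineForm

/-- The value of an affine form. -/
def eval (t : ℤ) (x : AffineForm) : ℤ := x.c + x.b * t

/-- Sum of affine forms. -/
def add (x y : AffineForm) : AffineForm := ⟨x.c + y.c, x.b + y.b⟩

/-- Difference of affine forms. -/
def sub (x y : AffineForm) : AffineForm := ⟨x.c - y.c, x.b - y.b⟩

/-- Twice an affine form. -/
def twice (x : AffineForm) : AffineForm := ⟨x.c + x.c, x.b + x.b⟩

/-- Multiple of an affine form. -/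
def smul (r : ℤ) (x : AffineForm) : AffineForm := ⟨r * x.c, r * x.b⟩

/-- Sufficient condition for nonnegativity at every `t ≥ 0`. -/
def isNonneg : AffineForm → Bool
  | ⟨.ofNat _, .ofNat _⟩ => true
  | _ => false

/-- Sufficient condition for `x ≤ y` at every `t ≥ 0`. -/
def isLe (x y : AffineForm) : Bool := (y.sub x).isNonneg

@[simp] theorem eval_add (t : ℤ) (x y : AffineForm) : (x.add y).eval t = x.eval t + y.eval t := by
  simp only [eval, add]; ring

@[simp] theorem eval_sub (t : ℤ) (x y : AffineForm) : (x.sub y).eval t = x.eval t - y.eval t := by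
  simp only [eval, sub]; ring

@[simp] theorem eval_twice (t : ℤ) (x : AffineForm) : x.twice.eval t = 2 * x.eval t := by
  simp only [eval, twice]; ring

@[simp] theorem eval_smul (t r : ℤ) (x : AffineForm) : (smul r x).eval t = r * x.eval t := by
  simp only [eval, smul]; ring

theorem eval_nonneg {t : ℤ} (ht : 0 ≤ t) {x : AffineForm} (h : x.isNonneg = true) :
    0 ≤ x.eval t := by
  match x, h with
  | ⟨.ofNat m, .ofNat n⟩, _ =>
    simp only [eval, Int.ofNat_eq_natCast]
    positivity

theorem eval_le {t : ℤ} (ht : 0 ≤ t) {x y : AffineForm} (h : x.isLe y = true) :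
    x.eval t ≤ y.eval t := by
  have := eval_nonneg ht h
  rw [eval_sub] at this
  omega

end AffineForm

open AffineForm

/-- `c` is the affine form of a constant. -/
def constForm (c : ℤ) : AffineForm := ⟨c, 0⟩

@[simp] theorem eval_constForm (t c : ℤ) : (constForm c).eval t = c := by
  simp [constForm, AffineForm.eval]

/-! ### Certificates that translations shorten all vectors in a box -/

/-- The vector of integers `us` lies in the box with the given lower and upper bounds. -/
def InBox (t : ℤ) : List ℤ → List (AffineForm × AffineForm) → Prop :=
  List.Forall₂ fun u p => p.1.eval t ≤ u ∧ u ≤ p.2.eval t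

/-- Sum of `u - |u - v|` over the coordinates. -/
def totalGain (t : ℤ) : List ℤ → List AffineForm → ℤ
  | u :: us, v :: vs => u - |u - v.eval t| + totalGain t us vs
  | _, _ => 0

/-- Translation by `v` decreases the norm of every nonnegative vector of the box. The accumulator
`p` adds lower bounds for `u - |u - v|`, and `q` adds lower bounds for `u - |u - v| - 2 * u`. -/
def shrinks : List (AffineForm × AffineForm) → List AffineForm → AffineForm → AffineForm → Bool
  | (lo, hi) :: bs, v :: vs, p, q =>
    if v.isLe (constForm 0) || v.isLe lo then
      shrinks bs vs (p.add v) (q.add (v.sub hi.twice))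
    else if hi.isLe v then
      shrinks bs vs (p.add (lo.twice.sub v)) (q.sub v)
    else if lo.isLe v then
      shrinks bs vs (p.add (lo.twice.sub v)) (q.add ((lo.twice.sub v).sub hi.twice))
    else false
  | [], [], p, q => (constForm 1).isLe p || (constForm 1).isLe q
  | _, _, _, _ => false

/-- The gain u − |u − v| of a coordinate is v when v ≤ u, is 2u − v when u ≤ v, and is at least 2·lo
− v when lo ≤ v. Coordinates of the first kind suit `p`, where the bound is exact. Those of the
second suit `q`, where subtracting 2u leaves the exact value −v; the subtracted total 2∑u is
recovered later from the known sum of the coordinates. -/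
theorem one_le_of_shrinks {t : ℤ} (ht : 0 ≤ t) {us : List ℤ}
    {bs : List (AffineForm × AffineForm)} (hb : InBox t us bs) (hu : ∀ u ∈ us, 0 ≤ u)
    {vs : List AffineForm} {p q : AffineForm} (h : shrinks bs vs p q = true) :
    1 ≤ p.eval t + totalGain t us vs ∨ 1 ≤ q.eval t + totalGain t us vs - 2 * us.sum := by
  induction hb generalizing vs p q with
  | nil =>
    cases vs with
    | nil =>
      simp only [shrinks, Bool.or_eq_true] at h
      rcases h with h | h
      · exact Or.inl (by simpa [totalGain] using eval_le ht h)
      · exact Or.inr (by simpa [totalGain] using eval_le ht h)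
    | cons v vs => simp [shrinks] at h
  | @cons u b us bs hub hb ih =>
    obtain ⟨lo, hi⟩ := b
    cases vs with
    | nil => simp [shrinks] at h
    | cons v vs =>
      have hu0 : 0 ≤ u := hu u (by simp)
      have ih := @ih (fun w hw => hu w (by simp [hw])) vs
      simp only [List.sum_cons, totalGain]
      simp only at hub
      rw [shrinks] at h
      split_ifs at h with h1 h2 h3
      · have hg : u - |u - v.eval t| = v.eval t := by
          rw [abs_of_nonneg]
          · ring
          · rcases Bool.or_eq_true _ _ ▸ h1 with h1 | h1
            · have := eval_le ht h1
              rw [eval_constForm] at this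
              omega
            · have := eval_le ht h1
              omega
        rcases ih h with h | h <;> simp only [eval_add, eval_sub, eval_twice] at h
        · left; omega
        · right; omega
      · have h2 := eval_le ht h2
        have hg : u - |u - v.eval t| = 2 * u - v.eval t := by
          rw [abs_of_nonpos (by omega)]
          ring
        rcases ih h with h | h <;> simp only [eval_add, eval_sub, eval_twice] at h
        · left; omega
        · right; omega
      · have h3 := eval_le ht h3
        have hg : 2 * lo.eval t - v.eval t ≤ u - |u - v.eval t| := by
          rcases abs_cases (u - v.eval t) with h | h <;> omega
        rcases ih h with h | h <;> simp only [eval_add, eval_sub, eval_twice] at h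
        · left; omega
        · right; omega

/-- The box contains no vector with sum `K`, by comparing the sum of the bounds. -/
def avoidsSum (K : AffineForm) (bs : List (AffineForm × AffineForm)) : Bool :=
  (K.add (constForm 1)).isLe (bs.foldr (fun b s => b.1.add s) (constForm 0)) ||
    ((bs.foldr (fun b s => b.2.add s) (constForm 0)).add (constForm 1)).isLe K

theorem InBox.sum_le {t : ℤ} {us : List ℤ} {bs : List (AffineForm × AffineForm)}
    (h : InBox t us bs) :
    (bs.foldr (fun b s => b.1.add s) (constForm 0)).eval t ≤ us.sum ∧
      us.sum ≤ (bs.foldr (fun b s => b.2.add s) (constForm 0)).eval t := by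
  induction h with
  | nil => simp
  | cons h _ ih =>
    simp only [List.foldr_cons, eval_add, List.sum_cons]
    omega

theorem sum_ne_of_avoidsSum {t : ℤ} (ht : 0 ≤ t) {us : List ℤ}
    {bs : List (AffineForm × AffineForm)} (hb : InBox t us bs) {K : AffineForm}
    (h : avoidsSum K bs = true) : us.sum ≠ K.eval t := by
  have hs := hb.sum_le
  rcases (Bool.or_eq_true _ _ ▸ h : _ ∨ _) with h | h <;>
  · have := eval_le ht h
    simp only [eval_add, eval_constForm] at this
    omega

/-- A decision tree: an inner node compares a coordinate with a threshold, and a leaf names a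
vector. -/
inductive CoverTree where
  | leaf (j : ℕ)
  | node (i n : ℕ) (l r : CoverTree)

/-- Certified covering: every vector with sum `K` in the box is shortened by one of the `vecs`. -/
def CoverTree.check (thr : ℕ → AffineForm) (vecs : ℕ → List AffineForm) (K : AffineForm) :
    CoverTree → List (AffineForm × AffineForm) → Bool
  | .leaf j, bs => avoidsSum K bs || shrinks bs (vecs j) (constForm 0) K.twice
  | .node i n l r, bs =>
    l.check thr vecs K (bs.modify i fun b => (b.1, (thr n).sub (constForm 1))) &&
      r.check thr vecs K (bs.modify i fun b => (thr n, b.2))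

/-- For integers, u < x means u ≤ x − 1, so the boxes of the two children cover that of their
parent. -/
theorem InBox.modify {t : ℤ} {us : List ℤ} {bs : List (AffineForm × AffineForm)}
    (h : InBox t us bs) (i : ℕ) (x : AffineForm) :
    InBox t us (bs.modify i fun b => (b.1, x.sub (constForm 1))) ∨
      InBox t us (bs.modify i fun b => (x, b.2)) := by
  induction h generalizing i with
  | nil => left; cases i <;> exact List.Forall₂.nil
  | @cons u b us bs hub hb ih =>
    cases i with
    | zero =>
      rcases lt_or_ge u (x.eval t) with hx | hx
      · refine Or.inl (List.Forall₂.cons ⟨hub.1, ?_⟩ hb)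
        simp only [eval_sub, eval_constForm]
        omega
      · exact Or.inr (List.Forall₂.cons ⟨hx, hub.2⟩ hb)
    | succ i => exact (ih i).imp (List.Forall₂.cons hub) (List.Forall₂.cons hub)

theorem CoverTree.exists_gain {thr : ℕ → AffineForm} {vecs : ℕ → List AffineForm}
    {K : AffineForm} {t : ℤ} (ht : 0 ≤ t) {us : List ℤ} (hu : ∀ u ∈ us, 0 ≤ u)
    (hK : us.sum = K.eval t) {T : CoverTree} {bs : List (AffineForm × AffineForm)}
    (hb : InBox t us bs) (h : T.check thr vecs K bs = true) :
    ∃ j, 1 ≤ totalGain t us (vecs j) := by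
  induction T generalizing bs with
  | leaf j =>
    rcases (Bool.or_eq_true _ _ ▸ h : _ ∨ _) with h | h
    · exact absurd hK (sum_ne_of_avoidsSum ht hb h)
    · refine ⟨j, ?_⟩
      -- The accumulators start at 0 and 2K. As the coordinates sum to K, both alternatives say that
      -- the gain is at least 1.
      have := one_le_of_shrinks ht hb hu h
      simp only [eval_constForm, eval_twice] at this
      omega
  | node i n l r ihl ihr =>
    obtain ⟨hl, hr⟩ := (Bool.and_eq_true _ _ ▸ h : _ ∧ _)
    rcases hb.modify i (thr n) with hb | hb
    · exact ihl hb hl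
    · exact ihr hb hr

/-! ### The order, the generators and the lattice of relations -/

/-- The order of the circulant graph of diameter `5 * a + 4`. -/
def circOrder (a : ℕ) : ℕ :=
  457 + 2186 * a + 4288 * a ^ 2 + 4352 * a ^ 3 + 2304 * a ^ 4 + 512 * a ^ 5

/-- The generators of the circulant graph of diameter `5 * a + 4`. -/
def circGen (a : ℕ) : Fin 5 → ℕ :=
  ![1, 35 + 92 * a + 88 * a ^ 2 + 32 * a ^ 3,
    116 + 434 * a + 640 * a ^ 2 + 448 * a ^ 3 + 128 * a ^ 4,
    143 + 512 * a + 720 * a ^ 2 + 480 * a ^ 3 + 128 * a ^ 4,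
    220 + 850 * a + 1272 * a ^ 2 + 896 * a ^ 3 + 256 * a ^ 4]

/-- The lattice of relations between the generators, given by a basis with coefficients that are
linear in `a`. -/
def relationVec (a : ℤ) (c : Fin 5 → ℤ) : Fin 5 → ℤ :=
  ![-c 0 + c 1 + c 2 - c 3 + (2 * a + 2) * c 4,
    (4 * a + 3) * c 0 - c 1 + c 3 + (2 * a + 2) * c 4,
    c 0 + (4 * a + 3) * c 1 - c 2 + (2 * a + 1) * c 4,
    c 1 + (4 * a + 4) * c 2 + (2 * a + 2) * c 4,
    -c 0 + (4 * a + 4) * c 3 + (2 * a + 2) * c 4]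

/-- The five basis vectors evaluate to 0, n, n, 2n and 2n on the generators. -/
theorem sum_relationVec_mul_circGen (a : ℕ) (c : Fin 5 → ℤ) :
    ∑ i, relationVec a c i * (circGen a i : ℤ) =
      circOrder a * (c 1 + c 2 + 2 * c 3 + 2 * c 4) := by
  simp only [Fin.sum_univ_five, relationVec, circGen, circOrder, Matrix.cons_val]
  push_cast
  ring

/-- The witness solves z = `relationVec a c` for c. Since the first generator is 1, the relation ∑
zᵢ gᵢ = n t eliminates z₀, after which the solution has integer polynomial coefficients in t, z₁, …,
z₄. Only coordinate 0 then needs the relation; the others are identities. -/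
theorem exists_eq_relationVec {a : ℕ} {z : Fin 5 → ℤ}
    (h : (circOrder a : ℤ) ∣ ∑ i, z i * (circGen a i : ℤ)) : ∃ c, z = relationVec a c := by
  obtain ⟨t, ht⟩ := h
  simp only [Fin.sum_univ_five, circGen, circOrder, Matrix.cons_val] at ht
  push_cast at ht
  refine ⟨![
    (-102 - 430 * a - 680 * a ^ 2 - 480 * a ^ 3 - 128 * a ^ 4) * t
      + (8 + 16 * a + 8 * a ^ 2) * z 1 + (26 + 82 * a + 88 * a ^ 2 + 32 * a ^ 3) * z 2
      + (32 + 96 * a + 96 * a ^ 2 + 32 * a ^ 3) * z 3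
      + (49 + 162 * a + 176 * a ^ 2 + 64 * a ^ 3) * z 4,
    (-54 - 270 * a - 504 * a ^ 2 - 416 * a ^ 3 - 128 * a ^ 4) * t
      + (4 + 12 * a + 8 * a ^ 2) * z 1 + (14 + 54 * a + 72 * a ^ 2 + 32 * a ^ 3) * z 2
      + (17 + 64 * a + 80 * a ^ 2 + 32 * a ^ 3) * z 3
      + (26 + 106 * a + 144 * a ^ 2 + 64 * a ^ 3) * z 4,
    (-79 - 326 * a - 536 * a ^ 2 - 416 * a ^ 3 - 128 * a ^ 4) * t
      + (6 + 12 * a + 8 * a ^ 2) * z 1 + (20 + 62 * a + 72 * a ^ 2 + 32 * a ^ 3) * z 2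
      + (25 + 72 * a + 80 * a ^ 2 + 32 * a ^ 3) * z 3
      + (38 + 122 * a + 144 * a ^ 2 + 64 * a ^ 3) * z 4,
    (-118 - 462 * a - 696 * a ^ 2 - 480 * a ^ 3 - 128 * a ^ 4) * t
      + (9 + 16 * a + 8 * a ^ 2) * z 1 + (30 + 86 * a + 88 * a ^ 2 + 32 * a ^ 3) * z 2
      + (37 + 100 * a + 96 * a ^ 2 + 32 * a ^ 3) * z 3
      + (57 + 170 * a + 176 * a ^ 2 + 64 * a ^ 3) * z 4,
    (185 + 760 * a + 1216 * a ^ 2 + 896 * a ^ 3 + 256 * a ^ 4) * t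
      + (-14 - 28 * a - 16 * a ^ 2) * z 1 + (-47 - 144 * a - 160 * a ^ 2 - 64 * a ^ 3) * z 2
      + (-58 - 168 * a - 176 * a ^ 2 - 64 * a ^ 3) * z 3
      + (-89 - 284 * a - 320 * a ^ 2 - 128 * a ^ 3) * z 4], ?_⟩
  funext i
  fin_cases i <;> simp only [relationVec, Matrix.cons_val, Fin.mk_one, Fin.zero_eta,
    Fin.reduceFinMk]
  · linear_combination ht
  all_goals ring

/-- `relationVec a c` as a list of affine forms in `a - 2`. -/
def relationForm (c0 c1 c2 c3 c4 : ℤ) : List AffineForm :=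
  [⟨-c0 + c1 + c2 - c3 + 6 * c4, 2 * c4⟩, ⟨11 * c0 - c1 + c3 + 6 * c4, 4 * c0 + 2 * c4⟩,
    ⟨c0 + 11 * c1 - c2 + 5 * c4, 4 * c1 + 2 * c4⟩, ⟨c1 + 12 * c2 + 6 * c4, 4 * c2 + 2 * c4⟩,
    ⟨-c0 + 12 * c3 + 6 * c4, 4 * c3 + 2 * c4⟩]

theorem map_eval_relationForm (t : ℤ) (c : Fin 5 → ℤ) :
    (relationForm (c 0) (c 1) (c 2) (c 3) (c 4)).map (AffineForm.eval t) =
      List.ofFn (relationVec (t + 2) c) := by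
  simp only [relationForm, relationVec, List.map_cons, List.map_nil, List.ofFn_succ, List.ofFn_zero,
    AffineForm.eval]
  congr 1
  · simp; ring
  congr 1
  · simp; ring
  congr 1
  · simp; ring
  congr 1
  · simp; ring
  congr 1
  · simp; ring

/-! ### Lower bound: a vector far from the lattice -/

/-- An affine form below `|x|`, choosing the sign by the leading coefficient. -/
def absForm (x : AffineForm) : AffineForm :=
  if x.isLe (constForm 0) then (constForm 0).sub x else x

/-- Both x and −x lie below |x|, so the sign test affects only the quality of the bound. -/
theorem eval_absForm_le (t : ℤ) (x : AffineForm) : (absForm x).eval t ≤ |x.eval t| := by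
  unfold absForm
  split_ifs
  · simpa using neg_le_abs (x.eval t)
  · exact le_abs_self _

/-- A lower bound for the distance of two vectors. -/
def distForm : List AffineForm → List AffineForm → AffineForm
  | x :: xs, v :: vs => (absForm (x.sub v)).add (distForm xs vs)
  | _, _ => constForm 0

theorem eval_distForm_le (t : ℤ) (xs vs : List AffineForm) :
    (distForm xs vs).eval t ≤
      (List.zipWith (fun x v => |x - v|) (xs.map (eval t)) (vs.map (eval t))).sum := by
  induction xs generalizing vs with
  | nil => simp [distForm]
  | cons x xs ih =>
    cases vs with
    | nil => simp [distForm]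
    | cons v vs =>
      have := eval_absForm_le t (x.sub v)
      have := ih vs
      simp only [distForm, eval_add, eval_sub, List.map_cons, List.zipWith_cons_cons,
        List.sum_cons] at *
      omega

/-- `p` holds at all integers between `-6` and `6`. -/
def allSmall (p : ℤ → Bool) : Bool := (List.range 13).all fun m => p (m - 6)

theorem of_allSmall {p : ℤ → Bool} (h : allSmall p = true) {c : ℤ} (h1 : -6 ≤ c) (h2 : c ≤ 6) :
    p c = true := by
  have := List.all_eq_true.1 h (c + 6).toNat (by rw [List.mem_range]; omega)
  rwa [Int.toNat_of_nonneg (by omega), add_sub_cancel_right] at this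

/-- All relation vectors with small coordinates are at distance at least `5 * a + 4` from
`(a + 1, a + 1, a + 1, a + 1, a)`. -/
def centerIsFar : Bool :=
  allSmall fun c4 => allSmall fun c0 =>
    Nat.blt 6 (c4.natAbs + (2 * c0 + c4).natAbs) || allSmall fun c1 =>
    Nat.blt 6 (c4.natAbs + (2 * c0 + c4).natAbs + (2 * c1 + c4).natAbs) || allSmall fun c2 =>
    Nat.blt 6 (c4.natAbs + (2 * c0 + c4).natAbs + (2 * c1 + c4).natAbs + (2 * c2 + c4).natAbs) ||
    allSmall fun c3 =>
    Nat.blt 6 (c4.natAbs + (2 * c0 + c4).natAbs + (2 * c1 + c4).natAbs + (2 * c2 + c4).natAbs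
      + (2 * c3 + c4).natAbs) ||
    AffineForm.isLe ⟨14, 5⟩ (distForm [⟨3, 1⟩, ⟨3, 1⟩, ⟨3, 1⟩, ⟨3, 1⟩, ⟨2, 1⟩]
      (relationForm c0 c1 c2 c3 c4))

theorem centerIsFar_eq_true : centerIsFar = true := by decide +kernel

/-- A weight of at most 6 bounds |c₄| by 6 and, by the triangle inequality, |2cᵢ| by 6 for the other
coordinates. So the search range suffices, and no cut-off on a partial weight fires. -/
theorem le_of_centerIsFar {c : Fin 5 → ℤ}
    (h : |c 4| + |2 * c 0 + c 4| + |2 * c 1 + c 4| + |2 * c 2 + c 4| + |2 * c 3 + c 4| ≤ 6) :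
    AffineForm.isLe ⟨14, 5⟩ (distForm [⟨3, 1⟩, ⟨3, 1⟩, ⟨3, 1⟩, ⟨3, 1⟩, ⟨2, 1⟩]
      (relationForm (c 0) (c 1) (c 2) (c 3) (c 4))) = true := by
  simp only [← Int.natCast_natAbs] at h
  have key : ∀ {m : ℕ} {b : Bool}, (Nat.blt 6 m || b) = true → m ≤ 6 → b = true := by
    intro m b h hm
    rcases (Bool.or_eq_true _ _ ▸ h : _ ∨ _) with h | h
    · exact absurd (Nat.blt_eq ▸ h : 6 < m) (by omega)
    · exact h
  have h4 := of_allSmall centerIsFar_eq_true (c := c 4) (by omega) (by omega)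
  have h0 := key (of_allSmall h4 (c := c 0) (by omega) (by omega)) (by omega)
  have h1 := key (of_allSmall h0 (c := c 1) (by omega) (by omega)) (by omega)
  have h2 := key (of_allSmall h1 (c := c 2) (by omega) (by omega)) (by omega)
  exact key (of_allSmall h2 (c := c 3) (by omega) (by omega)) (by omega)

/-- The basis of the relation lattice is diagonally dominant up to a change of coordinates. -/
theorem mul_le_norm_relationVec {a : ℤ} (ha : 0 ≤ a) (c : Fin 5 → ℤ) :
    2 * a * (|c 4| + |2 * c 0 + c 4| + |2 * c 1 + c 4| + |2 * c 2 + c 4| + |2 * c 3 + c 4|) ≤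
      ∑ i, |relationVec a c i| := by
  obtain ⟨w, hw⟩ : ∃ w, w = c 4 := ⟨_, rfl⟩
  obtain ⟨w0, h0⟩ : ∃ w0, w0 = 2 * c 0 + c 4 := ⟨_, rfl⟩
  obtain ⟨w1, h1⟩ : ∃ w1, w1 = 2 * c 1 + c 4 := ⟨_, rfl⟩
  obtain ⟨w2, h2⟩ : ∃ w2, w2 = 2 * c 2 + c 4 := ⟨_, rfl⟩
  obtain ⟨w3, h3⟩ : ∃ w3, w3 = 2 * c 3 + c 4 := ⟨_, rfl⟩
  have habs : ∀ {b x e : ℤ}, 0 ≤ b → b * |x| - |e| ≤ |b * x + e| := by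
    intro b x e hb
    have := abs_sub_abs_le_abs_sub (b * x) (-e)
    rwa [abs_mul, abs_of_nonneg hb, abs_neg, sub_neg_eq_add] at this
  -- In the coordinates w = c₄, wᵢ = 2cᵢ + c₄, each doubled row has one entry 4a + 3 or 4a + 4, and
  -- its other entries are 0 or ±1.
  have e0 : 2 * relationVec a c 0 = (4 * a + 4) * w + (-w0 + w1 + w2 - w3) := by
    simp only [relationVec, Matrix.cons_val]; rw [hw, h0, h1, h2, h3]; ring
  have e1 : 2 * relationVec a c 1 = (4 * a + 3) * w0 + (w - w1 + w3) := by
    simp only [relationVec, Matrix.cons_val]; rw [hw, h0, h1, h3]; ring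
  have e2 : 2 * relationVec a c 2 = (4 * a + 3) * w1 + (-w + w0 - w2) := by
    simp only [relationVec, Matrix.cons_val]; rw [hw, h0, h1, h2]; ring
  have e3 : 2 * relationVec a c 3 = (4 * a + 4) * w2 + (-w + w1) := by
    simp only [relationVec, Matrix.cons_val]; rw [hw, h1, h2]; ring
  have e4 : 2 * relationVec a c 4 = (4 * a + 4) * w3 + (w - w0) := by
    simp only [relationVec, Matrix.cons_val]; rw [hw, h0, h3]; ring
  have f : ∀ i, 2 * |relationVec a c i| = |2 * relationVec a c i| := fun i => by
    rw [abs_mul]; rfl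
  have g0 := habs (b := 4 * a + 4) (x := w) (e := -w0 + w1 + w2 - w3) (by omega)
  have g1 := habs (b := 4 * a + 3) (x := w0) (e := w - w1 + w3) (by omega)
  have g2 := habs (b := 4 * a + 3) (x := w1) (e := -w + w0 - w2) (by omega)
  have g3 := habs (b := 4 * a + 4) (x := w2) (e := -w + w1) (by omega)
  have g4 := habs (b := 4 * a + 4) (x := w3) (e := w - w0) (by omega)
  rw [← e0, ← f] at g0
  rw [← e1, ← f] at g1
  rw [← e2, ← f] at g2
  rw [← e3, ← f] at g3
  rw [← e4, ← f] at g4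
  have k0 : |-w0 + w1 + w2 - w3| ≤ |w0| + |w1| + |w2| + |w3| := by
    rcases abs_cases (-w0 + w1 + w2 - w3) with h | h <;>
      linarith [neg_le_abs w0, le_abs_self w0, neg_le_abs w1, le_abs_self w1, neg_le_abs w2,
        le_abs_self w2, neg_le_abs w3, le_abs_self w3]
  have k1 : |w - w1 + w3| ≤ |w| + |w1| + |w3| := by
    rcases abs_cases (w - w1 + w3) with h | h <;>
      linarith [neg_le_abs w, le_abs_self w, neg_le_abs w1, le_abs_self w1, neg_le_abs w3,
        le_abs_self w3]
  have k2 : |-w + w0 - w2| ≤ |w| + |w0| + |w2| := by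
    rcases abs_cases (-w + w0 - w2) with h | h <;>
      linarith [neg_le_abs w, le_abs_self w, neg_le_abs w0, le_abs_self w0, neg_le_abs w2,
        le_abs_self w2]
  have k3 : |-w + w1| ≤ |w| + |w1| := by
    rcases abs_cases (-w + w1) with h | h <;>
      linarith [neg_le_abs w, le_abs_self w, neg_le_abs w1, le_abs_self w1]
  have k4 : |w - w0| ≤ |w| + |w0| := by
    rcases abs_cases (w - w0) with h | h <;>
      linarith [neg_le_abs w, le_abs_self w, neg_le_abs w0, le_abs_self w0]
  rw [Fin.sum_univ_five, ← h0, ← h1, ← h2, ← h3, ← hw]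
  -- Off the diagonal |w| occurs four times, |w₀| and |w₁| three times, |w₂| and |w₃| twice. Every
  -- variable thus keeps a coefficient of at least 4a, with a surplus of 2 for the last two.
  have := abs_nonneg w2
  have := abs_nonneg w3
  linarith

/-- `(a + 1, a + 1, a + 1, a + 1, a)`, a vector far from the relation lattice. -/
def centerVec (a : ℤ) : Fin 5 → ℤ := ![a + 1, a + 1, a + 1, a + 1, a]

theorem le_dist_centerVec {a : ℤ} (ha : 2 ≤ a) (c : Fin 5 → ℤ) :
    5 * a + 4 ≤ ∑ i, |centerVec a i - relationVec a c i| := by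
  by_contra! hlt
  have hx : ∑ i, |centerVec a i| = 5 * a + 4 := by
    simp only [Fin.sum_univ_five, centerVec, Matrix.cons_val]
    rw [abs_of_nonneg (by omega : 0 ≤ a + 1), abs_of_nonneg (by omega : 0 ≤ a)]
    ring
  have hz : ∑ i, |relationVec a c i| ≤ ∑ i, |centerVec a i - relationVec a c i| +
      ∑ i, |centerVec a i| := by
    rw [← Finset.sum_add_distrib]
    refine Finset.sum_le_sum fun i _ => ?_
    have := abs_sub_abs_le_abs_sub (relationVec a c i) (centerVec a i)
    rw [abs_sub_comm] at this
    omega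
  have hW := mul_le_norm_relationVec (by omega : 0 ≤ a) c
  -- A relation closer than 5a + 4 has norm below 10a + 8, while weight 7 or more forces norm at
  -- least 14a. These conflict once a ≥ 2.
  have h6 : |c 4| + |2 * c 0 + c 4| + |2 * c 1 + c 4| + |2 * c 2 + c 4| + |2 * c 3 + c 4| ≤ 6 := by
    by_contra! h7
    nlinarith
  have h1 := eval_le (t := a - 2) (by omega) (le_of_centerIsFar h6)
  have h2 := eval_distForm_le (a - 2) [⟨3, 1⟩, ⟨3, 1⟩, ⟨3, 1⟩, ⟨3, 1⟩, ⟨2, 1⟩]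
    (relationForm (c 0) (c 1) (c 2) (c 3) (c 4))
  rw [map_eval_relationForm, sub_add_cancel] at h2
  simp only [List.ofFn_succ, List.ofFn_zero, List.map_cons, List.map_nil, List.zipWith_cons_cons,
    List.zipWith_nil_left, List.sum_cons, List.sum_nil, AffineForm.eval] at h1 h2
  have e1 : ∀ y, |3 + 1 * (a - 2) - y| = |a + 1 - y| := fun y => by congr 1; ring
  have e2 : ∀ y, |2 + 1 * (a - 2) - y| = |a - y| := fun y => by congr 1; ring
  simp only [e1, e2] at h2
  have h3 : ∑ i, |centerVec a i - relationVec a c i| = |a + 1 - relationVec a c 0| +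
      (|a + 1 - relationVec a c 1| + (|a + 1 - relationVec a c 2| + (|a + 1 - relationVec a c 3| +
      (|a - relationVec a c 4| + 0)))) := by
    simp only [Fin.sum_univ_five, centerVec, Matrix.cons_val]
    ring
  rw [h3] at hlt
  have h4 := h1.trans h2
  refine absurd (lt_of_le_of_lt h4 hlt) ?_
  omega

/-! ### Upper bound: covering certificates for the orthants -/

/-- The thresholds `1, 2, 3` and `2 * a - 1, ..., 2 * a + 5`, as affine forms in `a - 2`. -/
def threshold (n : ℕ) : AffineForm :=
  if n ≤ 3 then ⟨n, 0⟩ else ⟨n - 1, 2⟩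

/-- Coordinates of the short relation vectors. -/
def shortCoords : List (ℤ × ℤ × ℤ × ℤ × ℤ) :=
  [(-1, 0, 0, 0, 0), (0, -1, 0, 0, 0), (0, 0, -1, 0, 0), (0, 0, 0, -1, 0), (0, 0, 0, 1, 0),
  (0, 0, 1, 0, 0), (0, 1, 0, 0, 0), (1, 0, 0, 0, 0), (-1, -1, -1, -1, 2), (-1, -1, 0, 0, 0),
  (-1, 0, -1, 0, 0), (-1, 0, 0, 1, 0), (0, -1, 0, -1, 0), (0, -1, 1, 0, 0), (0, 1, -1, 0, 0),
  (0, 1, 0, 1, 0), (1, 0, 0, -1, 0), (1, 0, 1, 0, 0), (1, 1, 0, 0, 0), (-1, 0, -1, -1, 2),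
  (0, -1, -1, -1, 2), (-1, 1, 0, 0, 0), (0, 0, -1, -1, 0), (0, 0, 1, 1, 0), (-1, -1, -2, -1, 2),
  (-1, -1, -1, -2, 2), (-1, -1, -1, 0, 2), (0, 0, 0, 0, -1), (0, 0, 0, 1, -1), (0, 0, 1, 0, -1),
  (0, 0, 1, 1, -1), (0, 1, 0, 0, -1), (0, 1, 0, 1, -1), (0, 1, 1, 0, -1), (0, 1, 1, 1, -1),
  (1, 0, 0, 0, -1), (1, 0, 1, 0, -1), (1, 0, 1, 1, -1), (1, 1, 0, 0, -1), (1, 1, 0, 1, -1),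
  (1, 1, 1, 0, -1), (1, 1, 1, 1, -1), (-1, -1, -1, -1, 1), (-1, -1, -1, 0, 1),
  (-1, -1, 0, -1, 1), (-1, -1, 0, 0, 1), (-1, 0, -1, -1, 1), (-1, 0, -1, 0, 1),
  (-1, 0, 0, -1, 1), (-1, 0, 0, 0, 1), (0, -1, -1, -1, 1), (0, -1, -1, 0, 1), (0, -1, 0, -1, 1),
  (0, -1, 0, 0, 1), (0, 0, -1, -1, 1), (0, 0, -1, 0, 1), (0, 0, 0, -1, 1), (0, 0, 0, 0, 1)]

/-- Covering certificate for the orthant with signs `+, +, +, +, +`. -/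
def coverTreePPPP : CoverTree :=
  .node 1 9 (.node 2 9 (.node 3 9 (.node 4 9 (.node 0 10 (.node 2 8 (.node 0 9 (.node 3 8
  (.node 4 8 (.node 1 8 (.node 1 7 (.node 2 1 (.node 0 8 (.leaf 57) (.node 1 1 (.leaf 49)
  (.node 4 1 (.leaf 56) (.leaf 8)))) (.node 2 2 (.node 0 8 (.leaf 57) (.node 1 1 (.leaf 49)
  (.node 4 1 (.leaf 56) (.leaf 8)))) (.node 0 1 (.node 4 7 (.leaf 41) (.node 2 7 (.leaf 57)
  (.node 3 1 (.leaf 55) (.leaf 15)))) (.node 2 7 (.node 0 8 (.leaf 57) (.node 4 1 (.leaf 56)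
  (.node 1 1 (.node 2 6 (.leaf 49) (.leaf 19)) (.leaf 8)))) (.node 3 1 (.node 0 7 (.leaf 55)
  (.node 4 1 (.node 0 8 (.leaf 54) (.leaf 19)) (.leaf 19))) (.leaf 6)))))) (.node 0 8 (.node 2 7
  (.leaf 57) (.node 3 1 (.node 0 4 (.leaf 55) (.leaf 55)) (.leaf 18))) (.leaf 20))) (.node 2 1
  (.node 0 7 (.node 3 7 (.leaf 53) (.leaf 17)) (.leaf 20)) (.leaf 7))) (.node 1 1 (.node 2 6
  (.leaf 49) (.node 3 1 (.node 2 7 (.node 0 4 (.leaf 47) (.leaf 47)) (.leaf 15)) (.leaf 15)))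
  (.leaf 4))) (.node 0 1 (.node 1 7 (.node 4 7 (.leaf 41) (.node 1 1 (.node 4 8 (.node 2 4
  (.leaf 34) (.leaf 0)) (.leaf 23)) (.leaf 23))) (.leaf 17)) (.leaf 5))) (.node 1 1 (.node 4 1
  (.node 2 6 (.node 3 8 (.leaf 48) (.leaf 5)) (.leaf 19)) (.leaf 8)) (.leaf 8))) (.node 0 1
  (.node 3 1 (.node 1 7 (.node 4 7 (.leaf 39) (.leaf 15)) (.leaf 18)) (.leaf 6)) (.leaf 6)))
  (.leaf 8)) (.leaf 4)) (.leaf 5)) (.leaf 6)) (.leaf 7)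

/-- Covering certificate for the orthant with signs `+, -, +, +, +`. -/
def coverTreeMPPP : CoverTree :=
  .node 1 9 (.node 2 9 (.node 3 9 (.node 4 9 (.node 0 10 (.node 2 8 (.node 1 8 (.node 3 8
  (.node 2 7 (.node 0 9 (.node 0 1 (.node 4 8 (.leaf 34) (.node 1 7 (.node 2 6 (.leaf 49)
  (.node 3 1 (.leaf 47) (.leaf 15))) (.leaf 11))) (.node 1 7 (.node 2 6 (.leaf 49) (.node 3 1
  (.node 0 8 (.leaf 47) (.node 4 1 (.leaf 46) (.leaf 19))) (.node 1 1 (.node 4 1 (.leaf 56)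
  (.node 0 8 (.node 4 8 (.leaf 57) (.leaf 15)) (.leaf 19))) (.leaf 6)))) (.node 4 1 (.node 2 6
  (.leaf 48) (.node 3 1 (.leaf 46) (.leaf 6))) (.leaf 0)))) (.node 4 1 (.node 2 6 (.leaf 48)
  (.leaf 19)) (.leaf 8))) (.node 0 8 (.node 4 8 (.node 4 1 (.node 0 1 (.node 1 1 (.leaf 0)
  (.node 3 1 (.leaf 0) (.leaf 6))) (.node 1 1 (.node 3 1 (.leaf 0) (.leaf 6)) (.leaf 6)))
  (.node 0 7 (.node 4 3 (.node 0 1 (.node 3 2 (.leaf 21) (.node 1 1 (.leaf 0) (.leaf 6)))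
  (.node 1 1 (.node 3 1 (.leaf 0) (.leaf 6)) (.leaf 6))) (.node 0 3 (.node 0 1 (.node 3 1
  (.leaf 32) (.node 1 1 (.node 4 7 (.leaf 41) (.leaf 15)) (.leaf 6))) (.node 1 1 (.node 3 1
  (.leaf 0) (.leaf 6)) (.leaf 6))) (.node 1 1 (.node 3 1 (.leaf 55) (.leaf 6)) (.leaf 6))))
  (.leaf 19))) (.leaf 15)) (.leaf 19))) (.node 0 1 (.node 4 8 (.node 2 7 (.leaf 34) (.node 1 1
  (.node 4 4 (.leaf 41) (.leaf 0)) (.leaf 6))) (.leaf 23)) (.leaf 5))) (.node 0 1 (.node 4 1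
  (.node 2 7 (.leaf 33) (.node 3 1 (.leaf 0) (.leaf 6))) (.leaf 0)) (.leaf 0))) (.node 0 1
  (.node 1 1 (.node 3 1 (.leaf 0) (.leaf 6)) (.leaf 6)) (.leaf 6))) (.leaf 8)) (.leaf 4))
  (.leaf 5)) (.leaf 6)) (.leaf 0)

/-- Covering certificate for the orthant with signs `+, +, -, +, +`. -/
def coverTreePMPP : CoverTree :=
  .node 1 9 (.node 2 9 (.node 3 9 (.node 4 9 (.node 0 10 (.node 0 9 (.node 3 8 (.node 2 8
  (.node 4 8 (.node 0 8 (.node 2 1 (.node 1 8 (.leaf 57) (.node 0 7 (.node 3 7 (.leaf 53)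
  (.leaf 17)) (.leaf 20))) (.node 1 1 (.node 3 7 (.leaf 45) (.node 0 1 (.leaf 30) (.leaf 5)))
  (.node 4 7 (.node 4 5 (.node 3 7 (.node 0 7 (.leaf 53) (.node 4 1 (.node 1 8 (.leaf 52)
  (.leaf 20)) (.leaf 8))) (.node 0 1 (.node 1 8 (.node 2 7 (.leaf 37) (.leaf 13)) (.leaf 17))
  (.leaf 5))) (.node 0 7 (.node 3 7 (.leaf 53) (.node 0 1 (.node 1 5 (.node 2 5 (.leaf 37)
  (.leaf 37)) (.leaf 37)) (.leaf 5))) (.leaf 8))) (.node 0 7 (.node 3 7 (.leaf 53) (.leaf 23))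
  (.leaf 8))))) (.node 1 7 (.node 3 1 (.node 1 1 (.node 2 1 (.leaf 0) (.node 4 1 (.leaf 0)
  (.leaf 8))) (.node 2 1 (.node 4 1 (.leaf 0) (.leaf 8)) (.leaf 8))) (.node 2 7 (.node 3 3
  (.node 4 1 (.node 1 1 (.leaf 0) (.node 2 1 (.leaf 0) (.leaf 8))) (.node 1 1 (.node 2 1
  (.leaf 49) (.leaf 8)) (.leaf 8))) (.node 4 7 (.node 3 7 (.node 1 3 (.node 1 1 (.node 2 1
  (.leaf 49) (.node 4 1 (.leaf 44) (.leaf 8))) (.node 2 1 (.node 4 1 (.leaf 0) (.leaf 8))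
  (.leaf 8))) (.node 2 1 (.node 4 1 (.leaf 56) (.leaf 8)) (.leaf 8))) (.node 2 1 (.node 1 1
  (.leaf 49) (.node 4 1 (.leaf 56) (.leaf 8))) (.leaf 5))) (.node 1 1 (.node 2 1 (.leaf 49)
  (.leaf 8)) (.leaf 8)))) (.node 1 1 (.node 4 1 (.node 3 4 (.leaf 44) (.leaf 0)) (.leaf 8))
  (.leaf 8)))) (.leaf 20))) (.node 1 1 (.node 2 1 (.leaf 49) (.node 0 8 (.node 3 7 (.leaf 45)
  (.leaf 23)) (.leaf 8))) (.leaf 4))) (.node 1 1 (.node 3 7 (.node 0 8 (.leaf 45) (.node 4 1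
  (.leaf 44) (.leaf 8))) (.leaf 13)) (.leaf 1))) (.node 0 1 (.node 2 1 (.node 1 7 (.node 4 7
  (.leaf 41) (.node 1 1 (.leaf 0) (.leaf 23))) (.leaf 17)) (.leaf 5)) (.leaf 5))) (.node 1 1
  (.node 2 1 (.node 4 1 (.leaf 5) (.leaf 8)) (.leaf 8)) (.leaf 8))) (.leaf 8)) (.leaf 4))
  (.leaf 5)) (.leaf 1)) (.leaf 7)

/-- Covering certificate for the orthant with signs `+, -, -, +, +`. -/
def coverTreeMMPP : CoverTree :=
  .node 1 9 (.node 2 9 (.node 3 9 (.node 4 9 (.node 0 10 (.node 1 8 (.node 3 8 (.node 0 9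
  (.node 2 1 (.node 1 7 (.leaf 49) (.node 4 1 (.leaf 48) (.node 0 1 (.node 4 8 (.leaf 34)
  (.leaf 11)) (.leaf 0)))) (.node 1 7 (.node 4 1 (.node 3 7 (.leaf 44) (.node 0 1 (.node 2 8
  (.leaf 29) (.leaf 13)) (.leaf 5))) (.node 0 8 (.node 0 6 (.node 1 1 (.node 3 7 (.leaf 45)
  (.node 0 1 (.node 2 8 (.node 4 8 (.leaf 30) (.leaf 23)) (.leaf 13)) (.leaf 5))) (.node 1 6
  (.node 3 7 (.leaf 45) (.node 0 1 (.node 2 8 (.node 4 8 (.leaf 30) (.leaf 23)) (.leaf 13))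
  (.leaf 5))) (.node 0 1 (.node 2 8 (.node 4 8 (.leaf 30) (.leaf 11)) (.leaf 9)) (.leaf 0))))
  (.node 1 6 (.node 3 7 (.leaf 45) (.leaf 5)) (.leaf 0))) (.leaf 8))) (.node 0 1 (.node 4 1
  (.node 2 8 (.leaf 29) (.leaf 9)) (.leaf 0)) (.leaf 0)))) (.node 2 1 (.node 4 1 (.leaf 48)
  (.leaf 8)) (.leaf 8))) (.node 0 1 (.node 2 1 (.node 4 8 (.leaf 34) (.leaf 23)) (.leaf 5))
  (.leaf 5))) (.node 0 1 (.node 2 1 (.node 4 1 (.leaf 0) (.leaf 0)) (.leaf 0)) (.leaf 0)))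
  (.leaf 8)) (.leaf 4)) (.leaf 5)) (.leaf 1)) (.leaf 0)

/-- Covering certificate for the orthant with signs `+, +, +, -, +`. -/
def coverTreePPMP : CoverTree :=
  .node 1 9 (.node 2 9 (.node 3 9 (.node 4 9 (.node 0 10 (.node 0 8 (.node 1 8 (.node 3 8
  (.node 2 8 (.node 4 8 (.node 0 7 (.leaf 55) (.node 3 1 (.node 2 7 (.leaf 57) (.node 4 1
  (.node 1 4 (.leaf 54) (.leaf 54)) (.leaf 19))) (.node 1 7 (.node 4 1 (.leaf 54) (.node 1 1
  (.node 2 7 (.leaf 47) (.leaf 19)) (.leaf 8))) (.leaf 20)))) (.node 1 1 (.node 2 7 (.leaf 47)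
  (.leaf 15)) (.leaf 4))) (.node 0 1 (.node 4 7 (.node 1 7 (.node 3 7 (.leaf 39) (.leaf 14))
  (.leaf 18)) (.leaf 15)) (.leaf 6))) (.node 2 1 (.node 0 7 (.node 1 1 (.leaf 43) (.node 4 1
  (.leaf 50) (.node 4 8 (.node 0 6 (.leaf 51) (.leaf 24)) (.leaf 4)))) (.node 1 1 (.node 4 1
  (.leaf 0) (.leaf 24)) (.leaf 24))) (.leaf 2))) (.node 2 1 (.node 4 8 (.node 0 6 (.leaf 51)
  (.node 3 1 (.node 0 7 (.leaf 53) (.leaf 20)) (.leaf 20))) (.leaf 4)) (.leaf 7))) (.node 1 7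
  (.node 2 7 (.node 3 8 (.node 2 1 (.node 1 1 (.node 3 2 (.leaf 26) (.node 4 1 (.leaf 0)
  (.leaf 8))) (.node 4 1 (.node 3 1 (.leaf 0) (.leaf 8)) (.leaf 8))) (.node 0 9 (.node 3 7
  (.node 2 2 (.node 4 1 (.node 1 1 (.leaf 0) (.node 3 1 (.leaf 0) (.leaf 8))) (.node 1 1
  (.node 3 1 (.leaf 49) (.leaf 8)) (.leaf 8))) (.node 2 3 (.node 4 1 (.node 3 2 (.leaf 20)
  (.node 1 1 (.leaf 0) (.leaf 8))) (.node 1 1 (.node 3 1 (.leaf 49) (.leaf 8)) (.leaf 8)))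
  (.node 4 7 (.node 1 3 (.node 1 1 (.node 4 1 (.leaf 46) (.node 3 1 (.node 2 6 (.leaf 49)
  (.leaf 19)) (.leaf 8))) (.node 3 1 (.node 4 1 (.leaf 0) (.leaf 8)) (.leaf 8))) (.node 3 1
  (.node 4 1 (.leaf 56) (.leaf 8)) (.leaf 8))) (.node 1 1 (.node 3 1 (.node 2 5 (.leaf 49)
  (.leaf 0)) (.leaf 8)) (.leaf 8))))) (.node 1 1 (.node 4 1 (.leaf 46) (.leaf 8)) (.leaf 8)))
  (.node 4 1 (.node 3 1 (.node 1 1 (.leaf 0) (.leaf 8)) (.leaf 8)) (.leaf 8)))) (.leaf 24))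
  (.leaf 19)) (.leaf 20))) (.leaf 8)) (.leaf 4)) (.leaf 2)) (.leaf 6)) (.leaf 7)

/-- Covering certificate for the orthant with signs `+, -, +, -, +`. -/
def coverTreeMPMP : CoverTree :=
  .node 1 9 (.node 2 9 (.node 3 9 (.node 4 9 (.node 0 10 (.node 2 8 (.node 1 8 (.node 0 9
  (.node 3 8 (.node 4 1 (.node 2 7 (.leaf 46) (.node 0 8 (.node 1 1 (.leaf 54) (.node 0 1
  (.node 3 7 (.leaf 31) (.leaf 14)) (.leaf 6))) (.leaf 19))) (.node 0 8 (.node 3 7 (.node 0 1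
  (.node 4 8 (.leaf 32) (.node 1 7 (.node 2 7 (.leaf 47) (.leaf 15)) (.leaf 11))) (.node 1 7
  (.node 2 7 (.leaf 47) (.node 1 1 (.node 4 8 (.node 0 7 (.leaf 55) (.leaf 19)) (.leaf 15))
  (.leaf 6))) (.leaf 0))) (.node 1 7 (.node 2 7 (.leaf 47) (.node 1 1 (.node 4 4 (.node 0 4
  (.leaf 55) (.leaf 0)) (.leaf 55)) (.leaf 14))) (.leaf 10))) (.node 3 1 (.node 2 6 (.node 1 7
  (.leaf 49) (.leaf 0)) (.leaf 19)) (.leaf 8)))) (.node 2 1 (.node 0 8 (.node 1 7 (.node 4 1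
  (.leaf 42) (.node 0 7 (.node 1 6 (.leaf 43) (.leaf 10)) (.leaf 24))) (.leaf 10)) (.leaf 24))
  (.leaf 2))) (.node 3 1 (.node 4 1 (.node 2 6 (.leaf 48) (.leaf 19)) (.leaf 8)) (.leaf 8)))
  (.node 0 1 (.node 4 1 (.node 3 7 (.leaf 31) (.leaf 10)) (.leaf 0)) (.leaf 0))) (.node 0 1
  (.node 1 1 (.node 3 7 (.node 4 7 (.leaf 39) (.leaf 15)) (.leaf 14)) (.leaf 6)) (.leaf 6)))
  (.leaf 8)) (.leaf 4)) (.leaf 2)) (.leaf 6)) (.leaf 0)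

/-- Covering certificate for the orthant with signs `+, +, -, -, +`. -/
def coverTreePMMP : CoverTree :=
  .node 1 9 (.node 2 9 (.node 3 9 (.node 4 9 (.node 0 10 (.node 0 8 (.node 2 8 (.node 1 1
  (.node 0 7 (.leaf 43) (.node 3 1 (.leaf 45) (.node 4 1 (.leaf 42) (.node 2 1 (.node 3 8
  (.leaf 47) (.leaf 24)) (.leaf 8))))) (.node 4 8 (.node 0 7 (.node 3 1 (.leaf 53) (.node 2 7
  (.node 0 6 (.leaf 51) (.node 1 8 (.node 4 1 (.leaf 50) (.node 2 1 (.node 3 8 (.leaf 55)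
  (.leaf 24)) (.leaf 8))) (.leaf 20))) (.leaf 1))) (.node 1 8 (.node 3 8 (.node 1 3 (.node 2 1
  (.node 3 2 (.leaf 26) (.node 4 1 (.leaf 0) (.leaf 8))) (.node 3 1 (.node 4 1 (.leaf 0)
  (.leaf 8)) (.leaf 8))) (.node 2 3 (.node 2 1 (.node 3 1 (.leaf 57) (.node 4 1 (.node 1 7
  (.leaf 54) (.leaf 20)) (.leaf 8))) (.node 3 1 (.node 4 1 (.leaf 0) (.leaf 8)) (.leaf 8)))
  (.node 3 1 (.node 4 1 (.leaf 52) (.leaf 8)) (.leaf 8)))) (.leaf 24)) (.leaf 20))) (.leaf 4)))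
  (.node 1 1 (.node 3 1 (.leaf 45) (.leaf 1)) (.leaf 1))) (.node 1 7 (.node 3 8 (.node 1 1
  (.node 2 1 (.node 3 2 (.leaf 26) (.node 4 1 (.leaf 0) (.leaf 8))) (.node 4 1 (.node 3 1
  (.leaf 8) (.leaf 8)) (.leaf 8))) (.node 2 1 (.node 4 1 (.node 3 1 (.leaf 0) (.leaf 8))
  (.leaf 8)) (.leaf 8))) (.leaf 24)) (.leaf 20))) (.leaf 8)) (.leaf 4)) (.leaf 2)) (.leaf 1))
  (.leaf 7)

/-- Covering certificate for the orthant with signs `+, -, -, -, +`. -/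
def coverTreeMMMP : CoverTree :=
  .node 1 9 (.node 2 9 (.node 3 9 (.node 4 9 (.node 0 10 (.node 1 8 (.node 0 9 (.node 1 7
  (.node 2 8 (.node 4 1 (.node 0 8 (.leaf 42) (.node 3 1 (.leaf 44) (.node 2 1 (.node 3 8
  (.leaf 46) (.leaf 24)) (.leaf 8)))) (.node 0 8 (.node 2 1 (.node 3 8 (.leaf 47) (.node 0 7
  (.node 1 6 (.leaf 43) (.leaf 10)) (.leaf 24))) (.node 3 8 (.node 3 6 (.node 1 6 (.node 0 7
  (.leaf 43) (.node 3 1 (.leaf 45) (.leaf 8))) (.node 0 1 (.node 4 8 (.node 2 7 (.leaf 28)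
  (.node 3 1 (.leaf 30) (.leaf 9))) (.leaf 11)) (.leaf 0))) (.node 0 7 (.node 1 6 (.leaf 43)
  (.node 0 1 (.node 2 5 (.node 4 5 (.leaf 28) (.leaf 28)) (.leaf 28)) (.leaf 0))) (.leaf 8)))
  (.node 0 7 (.node 1 6 (.leaf 43) (.leaf 10)) (.leaf 8)))) (.node 3 1 (.node 2 1 (.leaf 49)
  (.leaf 8)) (.leaf 8)))) (.node 3 1 (.node 4 1 (.leaf 44) (.node 0 8 (.node 1 6 (.leaf 45)
  (.leaf 9)) (.leaf 8))) (.leaf 1))) (.node 2 8 (.node 3 8 (.node 4 8 (.node 3 2 (.node 0 1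
  (.node 4 3 (.leaf 9) (.node 2 1 (.leaf 0) (.leaf 0))) (.node 2 1 (.node 4 1 (.leaf 0)
  (.leaf 0)) (.leaf 0))) (.node 2 7 (.node 3 3 (.node 0 1 (.node 2 2 (.leaf 11) (.node 4 1
  (.leaf 0) (.leaf 0))) (.node 4 1 (.node 2 1 (.leaf 46) (.leaf 0)) (.leaf 0))) (.node 0 8
  (.node 2 3 (.node 2 1 (.node 4 1 (.leaf 46) (.node 0 1 (.node 3 7 (.leaf 32) (.leaf 10))
  (.leaf 0))) (.node 0 1 (.node 4 1 (.leaf 0) (.leaf 0)) (.leaf 0))) (.node 0 1 (.node 4 1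
  (.leaf 27) (.leaf 0)) (.leaf 0))) (.node 2 1 (.node 4 1 (.leaf 46) (.leaf 0)) (.leaf 0))))
  (.leaf 9))) (.leaf 11)) (.leaf 10)) (.leaf 9))) (.node 2 1 (.node 3 1 (.node 4 1 (.leaf 0)
  (.leaf 8)) (.leaf 8)) (.leaf 8))) (.node 0 1 (.node 2 1 (.node 4 1 (.leaf 0) (.leaf 0))
  (.leaf 0)) (.leaf 0))) (.leaf 8)) (.leaf 4)) (.leaf 2)) (.leaf 1)) (.leaf 0)

/-- Covering certificate for the orthant with signs `+, +, +, +, -`. -/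
def coverTreePPPM : CoverTree :=
  .node 1 9 (.node 2 9 (.node 3 9 (.node 4 9 (.node 0 10 (.node 2 8 (.node 1 8 (.node 3 8
  (.node 4 8 (.node 3 7 (.node 0 9 (.node 2 1 (.node 0 8 (.leaf 52) (.node 1 7 (.leaf 56)
  (.leaf 20))) (.node 1 7 (.node 2 7 (.leaf 56) (.node 0 8 (.node 3 1 (.leaf 54) (.node 0 1
  (.node 1 6 (.leaf 40) (.node 4 1 (.leaf 41) (.leaf 18))) (.leaf 6))) (.leaf 19))) (.node 4 1
  (.node 0 8 (.node 2 7 (.leaf 57) (.node 3 1 (.node 0 4 (.leaf 55) (.leaf 55)) (.leaf 18)))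
  (.leaf 20)) (.leaf 7)))) (.node 1 1 (.node 2 6 (.node 4 7 (.leaf 48) (.leaf 25)) (.leaf 19))
  (.leaf 8))) (.node 4 6 (.node 4 4 (.node 2 7 (.node 2 6 (.node 1 1 (.leaf 48) (.node 0 9
  (.node 1 7 (.leaf 56) (.node 4 1 (.node 0 4 (.leaf 57) (.leaf 57)) (.leaf 17))) (.leaf 8)))
  (.node 0 5 (.node 1 5 (.leaf 56) (.leaf 40)) (.leaf 56))) (.node 0 1 (.node 1 4 (.leaf 40)
  (.leaf 40)) (.leaf 6))) (.node 0 7 (.node 1 7 (.node 2 7 (.leaf 56) (.leaf 40)) (.leaf 17))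
  (.leaf 48))) (.node 0 5 (.node 1 5 (.node 2 5 (.leaf 56) (.leaf 33)) (.leaf 36)) (.leaf 48))))
  (.node 0 1 (.node 1 6 (.leaf 40) (.node 2 1 (.node 1 7 (.leaf 36) (.leaf 16)) (.leaf 16)))
  (.leaf 3))) (.node 0 1 (.node 1 6 (.leaf 40) (.node 4 1 (.node 1 7 (.leaf 41) (.leaf 17))
  (.leaf 17))) (.leaf 5))) (.node 4 1 (.node 2 1 (.node 0 7 (.node 3 7 (.leaf 53) (.leaf 17))
  (.leaf 20)) (.leaf 7)) (.leaf 7))) (.node 0 1 (.node 3 1 (.node 1 6 (.leaf 38) (.node 4 1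
  (.leaf 0) (.leaf 18))) (.leaf 6)) (.leaf 6))) (.leaf 8)) (.leaf 3)) (.leaf 5)) (.leaf 6))
  (.leaf 7)

/-- Covering certificate for the orthant with signs `+, -, +, +, -`. -/
def coverTreeMPPM : CoverTree :=
  .node 1 9 (.node 2 9 (.node 3 9 (.node 4 9 (.node 0 10 (.node 2 8 (.node 4 8 (.node 0 1
  (.node 2 7 (.leaf 33) (.node 1 1 (.leaf 40) (.node 3 1 (.leaf 31) (.leaf 6)))) (.node 1 8
  (.node 3 8 (.node 2 7 (.node 1 1 (.node 0 9 (.leaf 56) (.node 4 7 (.node 2 6 (.leaf 48)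
  (.leaf 19)) (.leaf 25))) (.node 4 7 (.node 2 6 (.leaf 48) (.node 3 1 (.node 0 9 (.leaf 46)
  (.leaf 19)) (.leaf 6))) (.leaf 3))) (.node 1 1 (.node 3 1 (.node 0 8 (.leaf 54) (.leaf 19))
  (.leaf 6)) (.leaf 6))) (.leaf 5)) (.leaf 0))) (.node 0 1 (.node 1 1 (.leaf 40) (.leaf 3))
  (.leaf 3))) (.node 0 1 (.node 1 1 (.node 3 1 (.leaf 0) (.leaf 6)) (.leaf 6)) (.leaf 6)))
  (.leaf 8)) (.leaf 3)) (.leaf 5)) (.leaf 6)) (.leaf 0)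

/-- Covering certificate for the orthant with signs `+, +, -, +, -`. -/
def coverTreePMPM : CoverTree :=
  .node 1 9 (.node 2 9 (.node 3 9 (.node 4 9 (.node 0 10 (.node 3 8 (.node 0 9 (.node 2 8
  (.node 1 8 (.node 4 8 (.node 2 1 (.node 1 7 (.leaf 56) (.node 0 8 (.node 3 7 (.leaf 52)
  (.node 4 1 (.leaf 57) (.leaf 17))) (.leaf 20))) (.node 3 7 (.node 0 8 (.leaf 52) (.node 1 1
  (.node 4 7 (.leaf 44) (.leaf 25)) (.leaf 8))) (.node 0 1 (.node 1 1 (.leaf 29) (.node 2 7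
  (.node 1 7 (.leaf 36) (.node 4 1 (.leaf 37) (.leaf 17))) (.leaf 13))) (.leaf 5)))) (.node 0 1
  (.node 1 7 (.node 2 7 (.leaf 36) (.leaf 12)) (.leaf 16)) (.leaf 3))) (.node 4 1 (.node 0 7
  (.node 3 7 (.leaf 53) (.leaf 17)) (.leaf 20)) (.leaf 7))) (.node 1 1 (.node 4 7 (.node 3 7
  (.leaf 44) (.leaf 13)) (.leaf 12)) (.leaf 1))) (.node 1 1 (.node 2 1 (.node 4 7 (.leaf 48)
  (.leaf 25)) (.leaf 8)) (.leaf 8))) (.node 0 1 (.node 2 1 (.node 1 6 (.leaf 40) (.node 4 1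
  (.leaf 0) (.leaf 17))) (.leaf 5)) (.leaf 5))) (.leaf 8)) (.leaf 3)) (.leaf 5)) (.leaf 1))
  (.leaf 7)

/-- Covering certificate for the orthant with signs `+, -, -, +, -`. -/
def coverTreeMMPM : CoverTree :=
  .node 1 9 (.node 2 9 (.node 3 9 (.node 4 9 (.node 0 10 (.node 3 8 (.node 4 8 (.node 1 8
  (.node 0 1 (.node 2 8 (.leaf 29) (.node 1 7 (.node 3 7 (.node 4 7 (.leaf 44) (.leaf 12))
  (.leaf 13)) (.leaf 9))) (.node 2 1 (.node 4 7 (.leaf 48) (.node 1 1 (.node 0 9 (.leaf 56)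
  (.leaf 25)) (.leaf 3))) (.node 0 9 (.node 1 7 (.node 3 7 (.node 4 7 (.leaf 44) (.node 1 1
  (.node 0 8 (.node 2 8 (.leaf 52) (.leaf 12)) (.leaf 25)) (.leaf 3))) (.leaf 5)) (.leaf 0))
  (.leaf 8)))) (.node 0 1 (.node 2 1 (.leaf 33) (.leaf 0)) (.leaf 0))) (.node 0 1 (.node 1 1
  (.node 2 7 (.leaf 36) (.leaf 12)) (.leaf 3)) (.leaf 3))) (.node 0 1 (.node 2 1 (.node 4 8
  (.leaf 33) (.node 1 1 (.leaf 0) (.leaf 3))) (.leaf 5)) (.leaf 5))) (.leaf 8)) (.leaf 3))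
  (.leaf 5)) (.leaf 1)) (.leaf 0)

/-- Covering certificate for the orthant with signs `+, +, +, -, -`. -/
def coverTreePPMM : CoverTree :=
  .node 1 9 (.node 2 9 (.node 3 9 (.node 4 9 (.node 0 10 (.node 1 8 (.node 0 9 (.node 2 8
  (.node 4 8 (.node 3 8 (.node 1 1 (.node 0 8 (.leaf 54) (.node 2 7 (.node 4 7 (.leaf 46)
  (.node 3 1 (.leaf 56) (.leaf 25))) (.leaf 19))) (.node 0 8 (.node 1 7 (.leaf 54) (.node 2 1
  (.node 0 7 (.leaf 50) (.node 3 1 (.leaf 52) (.leaf 20))) (.node 4 1 (.node 0 7 (.leaf 55)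
  (.node 3 1 (.node 2 4 (.leaf 57) (.leaf 57)) (.leaf 20))) (.leaf 7)))) (.node 3 1 (.node 1 7
  (.node 2 7 (.leaf 56) (.leaf 19)) (.leaf 20)) (.leaf 8)))) (.node 2 1 (.node 0 7 (.leaf 50)
  (.node 1 1 (.node 0 8 (.node 4 4 (.leaf 42) (.leaf 0)) (.leaf 24)) (.leaf 24))) (.leaf 2)))
  (.node 0 1 (.node 3 8 (.node 1 7 (.node 2 1 (.leaf 35) (.node 3 7 (.node 1 6 (.leaf 38)
  (.leaf 16)) (.leaf 22))) (.leaf 16)) (.leaf 22)) (.leaf 3))) (.node 0 1 (.node 3 7 (.node 1 6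
  (.leaf 38) (.node 4 1 (.node 1 7 (.leaf 39) (.leaf 18)) (.leaf 18))) (.leaf 14)) (.leaf 6)))
  (.node 3 1 (.node 1 1 (.node 2 6 (.node 4 7 (.leaf 48) (.leaf 25)) (.leaf 19)) (.leaf 8))
  (.leaf 8))) (.node 2 1 (.node 4 1 (.node 0 6 (.leaf 51) (.node 3 1 (.leaf 8) (.leaf 20)))
  (.leaf 7)) (.leaf 7))) (.leaf 8)) (.leaf 3)) (.leaf 2)) (.leaf 6)) (.leaf 7)

/-- Covering certificate for the orthant with signs `+, -, +, -, -`. -/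
def coverTreeMPMM : CoverTree :=
  .node 1 9 (.node 2 9 (.node 3 9 (.node 4 9 (.node 0 10 (.node 2 8 (.node 4 8 (.node 1 8
  (.node 0 9 (.node 3 8 (.node 1 1 (.node 0 8 (.leaf 54) (.node 2 7 (.node 4 7 (.leaf 46)
  (.node 3 1 (.leaf 56) (.leaf 25))) (.leaf 19))) (.node 2 7 (.node 4 7 (.leaf 46) (.node 0 1
  (.node 3 7 (.leaf 31) (.node 2 1 (.leaf 27) (.leaf 22))) (.leaf 3))) (.node 0 1 (.node 3 7
  (.leaf 31) (.leaf 14)) (.leaf 6)))) (.node 2 1 (.node 0 8 (.node 1 7 (.node 4 7 (.leaf 42)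
  (.node 1 1 (.node 0 4 (.leaf 50) (.leaf 0)) (.leaf 22))) (.leaf 10)) (.leaf 24)) (.leaf 2)))
  (.node 3 1 (.node 2 6 (.node 4 7 (.leaf 48) (.leaf 25)) (.leaf 19)) (.leaf 8))) (.node 0 1
  (.node 3 7 (.leaf 31) (.leaf 10)) (.leaf 0))) (.node 0 1 (.node 1 1 (.node 3 7 (.leaf 38)
  (.node 2 1 (.leaf 0) (.leaf 22))) (.leaf 3)) (.leaf 3))) (.node 0 1 (.node 1 1 (.node 3 7
  (.leaf 38) (.leaf 14)) (.leaf 6)) (.leaf 6))) (.leaf 8)) (.leaf 3)) (.leaf 2)) (.leaf 6))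
  (.leaf 0)

/-- Covering certificate for the orthant with signs `+, +, -, -, -`. -/
def coverTreePMMM : CoverTree :=
  .node 1 9 (.node 2 9 (.node 3 9 (.node 4 9 (.node 0 10 (.node 0 9 (.node 2 8 (.node 1 8
  (.node 4 8 (.node 3 1 (.node 0 8 (.leaf 52) (.node 1 7 (.node 2 1 (.leaf 56) (.node 1 1
  (.node 4 7 (.leaf 44) (.leaf 25)) (.leaf 8))) (.leaf 20))) (.node 0 8 (.node 1 1 (.node 4 7
  (.leaf 42) (.node 2 7 (.node 0 7 (.leaf 50) (.node 2 1 (.node 3 4 (.leaf 54) (.leaf 54))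
  (.leaf 25))) (.leaf 12))) (.node 2 7 (.node 0 7 (.leaf 50) (.node 2 1 (.node 3 8 (.node 1 7
  (.leaf 54) (.leaf 20)) (.leaf 24)) (.leaf 8))) (.leaf 1))) (.node 1 1 (.node 2 1 (.node 3 8
  (.node 4 7 (.leaf 46) (.leaf 25)) (.leaf 24)) (.leaf 8)) (.leaf 8)))) (.node 0 1 (.node 3 8
  (.node 1 7 (.node 2 6 (.leaf 35) (.node 3 1 (.node 2 7 (.leaf 36) (.leaf 12)) (.leaf 12)))
  (.leaf 16)) (.leaf 22)) (.leaf 3))) (.node 4 1 (.node 0 7 (.node 3 1 (.leaf 53) (.node 2 7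
  (.node 0 6 (.leaf 51) (.leaf 20)) (.leaf 1))) (.leaf 20)) (.leaf 7))) (.node 1 1 (.node 3 1
  (.node 4 7 (.leaf 44) (.leaf 12)) (.leaf 1)) (.leaf 1))) (.node 1 1 (.node 2 1 (.node 3 1
  (.leaf 3) (.leaf 8)) (.leaf 8)) (.leaf 8))) (.leaf 8)) (.leaf 3)) (.leaf 2)) (.leaf 1))
  (.leaf 7)

/-- Covering certificate for the orthant with signs `+, -, -, -, -`. -/
def coverTreeMMMM : CoverTree :=
  .node 1 9 (.node 2 9 (.node 3 9 (.node 4 9 (.node 0 10 (.node 4 8 (.node 1 8 (.node 0 9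
  (.node 2 1 (.node 0 1 (.node 3 8 (.leaf 27) (.node 1 7 (.node 4 7 (.leaf 42) (.node 1 1
  (.leaf 0) (.leaf 22))) (.leaf 10))) (.node 4 7 (.node 3 8 (.leaf 46) (.node 0 8 (.node 1 7
  (.leaf 42) (.leaf 10)) (.leaf 24))) (.node 1 1 (.node 0 7 (.leaf 50) (.node 3 4 (.node 0 8
  (.leaf 54) (.node 3 1 (.leaf 0) (.leaf 25))) (.leaf 54))) (.leaf 3)))) (.node 2 8 (.node 1 7
  (.node 0 8 (.node 4 7 (.leaf 42) (.node 1 1 (.node 3 1 (.leaf 52) (.node 2 7 (.node 0 7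
  (.leaf 50) (.leaf 25)) (.leaf 12))) (.node 0 1 (.node 3 1 (.leaf 29) (.node 3 8 (.node 2 7
  (.leaf 27) (.leaf 12)) (.leaf 22))) (.leaf 3)))) (.node 3 1 (.node 4 7 (.leaf 44) (.leaf 25))
  (.leaf 8))) (.node 0 1 (.node 3 1 (.leaf 29) (.node 3 8 (.node 2 7 (.leaf 27) (.leaf 9))
  (.leaf 10))) (.leaf 0))) (.node 3 1 (.node 1 7 (.node 4 7 (.leaf 44) (.leaf 12)) (.leaf 9))
  (.leaf 1)))) (.node 2 1 (.node 3 1 (.node 4 7 (.leaf 48) (.leaf 25)) (.leaf 8)) (.leaf 8)))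
  (.node 0 1 (.node 2 1 (.node 3 7 (.leaf 31) (.leaf 10)) (.leaf 0)) (.leaf 0))) (.node 0 1
  (.node 1 1 (.node 2 7 (.node 3 8 (.node 2 6 (.leaf 35) (.node 3 1 (.leaf 0) (.leaf 12)))
  (.leaf 22)) (.leaf 12)) (.leaf 3)) (.leaf 3))) (.leaf 8)) (.leaf 3)) (.leaf 2)) (.leaf 1))
  (.leaf 0)

/-- The short relation vectors, as affine forms in `a - 2`. -/
def shortForm (j : ℕ) : List AffineForm :=
  match shortCoords.getD j (0, 0, 0, 0, 0) with
  | (c0, c1, c2, c3, c4) => relationForm c0 c1 c2 c3 c4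

/-- Coordinatewise multiplication by signs. -/
def signedForm (s : List ℤ) (v : List AffineForm) : List AffineForm :=
  List.zipWith AffineForm.smul s v

/-- The tree certifies that all vectors of norm `5 * a + 5` in the orthant with signs `s` are
shortened by a relation vector, for all `a ≥ 2`. -/
def CoverTree.covers (T : CoverTree) (s : List ℤ) : Bool :=
  T.check threshold (fun j => signedForm s (shortForm j)) ⟨15, 5⟩
    (List.replicate 5 (constForm 0, ⟨15, 5⟩))

/-- Sixteen orthants suffice: L = −L allows the first sign to be taken as +. -/
theorem coverTreePPPP_covers : coverTreePPPP.covers [1, 1, 1, 1, 1] = true := by decide +kernel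

theorem coverTreeMPPP_covers : coverTreeMPPP.covers [1, -1, 1, 1, 1] = true := by decide +kernel

theorem coverTreePMPP_covers : coverTreePMPP.covers [1, 1, -1, 1, 1] = true := by decide +kernel

theorem coverTreeMMPP_covers : coverTreeMMPP.covers [1, -1, -1, 1, 1] = true := by decide +kernel

theorem coverTreePPMP_covers : coverTreePPMP.covers [1, 1, 1, -1, 1] = true := by decide +kernel

theorem coverTreeMPMP_covers : coverTreeMPMP.covers [1, -1, 1, -1, 1] = true := by decide +kernel

theorem coverTreePMMP_covers : coverTreePMMP.covers [1, 1, -1, -1, 1] = true := by decide +kernel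

theorem coverTreeMMMP_covers : coverTreeMMMP.covers [1, -1, -1, -1, 1] = true := by decide +kernel

theorem coverTreePPPM_covers : coverTreePPPM.covers [1, 1, 1, 1, -1] = true := by decide +kernel

theorem coverTreeMPPM_covers : coverTreeMPPM.covers [1, -1, 1, 1, -1] = true := by decide +kernel

theorem coverTreePMPM_covers : coverTreePMPM.covers [1, 1, -1, 1, -1] = true := by decide +kernel

theorem coverTreeMMPM_covers : coverTreeMMPM.covers [1, -1, -1, 1, -1] = true := by decide +kernel

theorem coverTreePPMM_covers : coverTreePPMM.covers [1, 1, 1, -1, -1] = true := by decide +kernel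

theorem coverTreeMPMM_covers : coverTreeMPMM.covers [1, -1, 1, -1, -1] = true := by decide +kernel

theorem coverTreePMMM_covers : coverTreePMMM.covers [1, 1, -1, -1, -1] = true := by decide +kernel

theorem coverTreeMMMM_covers : coverTreeMMMM.covers [1, -1, -1, -1, -1] = true := by decide +kernel

/-! ### Upper bound: shortening every vector of norm 5a + 5 -/

/-- The gain of a signed relation vector, in terms of the values of the affine forms. -/
theorem totalGain_signedForm (t : ℤ) (s u : Fin 5 → ℤ) (c : Fin 5 → ℤ) :
    totalGain t (List.ofFn u)
      (signedForm (List.ofFn s) (relationForm (c 0) (c 1) (c 2) (c 3) (c 4))) =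
      ∑ i, (u i - |u i - s i * relationVec (t + 2) c i|) := by
  have h := map_eval_relationForm t c
  simp only [relationForm, List.map_cons, List.map_nil, List.ofFn_succ, List.ofFn_zero,
    List.cons.injEq, and_true] at h
  obtain ⟨h0, h1, h2, h3, h4⟩ := h
  simp only [relationForm, signedForm, List.ofFn_succ, List.ofFn_zero, List.zipWith_cons_cons,
    List.zipWith_nil_left, totalGain, eval_smul, h0, h1, h2, h3, h4, Fin.sum_univ_five]
  simp only [Fin.succ_zero_eq_one, Fin.isValue, Fin.succ_one_eq_two, Fin.reduceSucc]
  ring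

theorem CoverTree.exists_relationVec {T : CoverTree} {s : Fin 5 → ℤ}
    (hT : T.covers (List.ofFn s) = true) {a : ℤ} (ha : 2 ≤ a) {u : Fin 5 → ℤ} (hu : ∀ i, 0 ≤ u i)
    (hsum : ∑ i, u i = 5 * a + 5) :
    ∃ c, ∑ i, |u i - s i * relationVec a c i| ≤ 5 * a + 4 := by
  have ht : 0 ≤ a - 2 := by omega
  have hle : ∀ i, u i ≤ 5 * a + 5 := fun i =>
    hsum ▸ Finset.single_le_sum (fun j _ => hu j) (Finset.mem_univ i)
  have hb : InBox (a - 2) (List.ofFn u) (List.replicate 5 (constForm 0, ⟨15, 5⟩)) := by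
    have : ∀ i, (constForm 0).eval (a - 2) ≤ u i ∧ u i ≤ AffineForm.eval (a - 2) ⟨15, 5⟩ := by
      intro i
      have := hle i
      refine ⟨by simpa using hu i, ?_⟩
      simp only [AffineForm.eval]
      omega
    simp only [List.ofFn_succ, List.ofFn_zero, List.replicate]
    exact .cons (this _) (.cons (this _) (.cons (this _) (.cons (this _) (.cons (this _) .nil))))
  obtain ⟨j, hj⟩ := CoverTree.exists_gain ht (us := List.ofFn u)
    (by simpa only [List.forall_mem_ofFn_iff] using hu)
    (by rw [List.sum_ofFn, hsum]; simp only [AffineForm.eval]; ring) hb hT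
  -- Any index j is sound: outside the list the default coordinates give the zero relation.
  obtain ⟨⟨c0, c1, c2, c3, c4⟩, hc⟩ : ∃ p, shortCoords.getD j (0, 0, 0, 0, 0) = p := ⟨_, rfl⟩
  have hf : shortForm j = relationForm c0 c1 c2 c3 c4 := by simp only [shortForm, hc]
  have hg := totalGain_signedForm (a - 2) s u ![c0, c1, c2, c3, c4]
  simp only [Matrix.cons_val, sub_add_cancel, Finset.sum_sub_distrib, hsum] at hg
  rw [hf, hg] at hj
  exact ⟨![c0, c1, c2, c3, c4], by omega⟩

theorem relationVec_neg (a : ℤ) (c : Fin 5 → ℤ) : relationVec a (-c) = -relationVec a c := by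
  funext i
  fin_cases i <;> simp [relationVec] <;> ring

/-- Changing signs of coordinates preserves the ℓ¹ norm, so the signs `e * s i` carry x to the
nonnegative vector |x|. The signs `s` are built into the certificate, and the global sign `e` is
absorbed by L = −L. -/
theorem CoverTree.exists_relationVec_of_signs {T : CoverTree} {s : Fin 5 → ℤ}
    (hT : T.covers (List.ofFn s) = true) (hs : ∀ i, |s i| = 1) {a : ℤ} (ha : 2 ≤ a) {e : ℤ}
    (he : |e| = 1) {x : Fin 5 → ℤ} (hx : ∀ i, x i = e * s i * |x i|)
    (hsum : ∑ i, |x i| = 5 * a + 5) :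
    ∃ c, ∑ i, |x i - relationVec a c i| ≤ 5 * a + 4 := by
  obtain ⟨c, hc⟩ := CoverTree.exists_relationVec hT ha (u := fun i => |x i|)
    (fun i => abs_nonneg _) hsum
  have hc' : ∑ i, |x i - e * relationVec a c i| ≤ 5 * a + 4 := by
    refine le_of_eq_of_le (Finset.sum_congr rfl fun i _ => ?_) hc
    have h1 : x i - e * relationVec a c i = e * s i * (|x i| - s i * relationVec a c i) := by
      have : s i * s i = 1 := by rw [← abs_mul_abs_self, hs i, one_mul]
      rw [mul_sub, ← hx i]
      linear_combination (e * relationVec a c i) * this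
    rw [h1, abs_mul, abs_mul, he, hs i, one_mul, one_mul]
  rcases (abs_eq zero_le_one).1 he with rfl | rfl
  · exact ⟨c, by simpa using hc'⟩
  · refine ⟨-c, ?_⟩
    rw [relationVec_neg]
    simpa using hc'

theorem exists_relationVec_near {a : ℤ} (ha : 2 ≤ a) {x : Fin 5 → ℤ}
    (hsum : ∑ i, |x i| = 5 * a + 5) : ∃ c, ∑ i, |x i - relationVec a c i| ≤ 5 * a + 4 := by
  have hsign : ∀ y : ℤ, ∃ e : ℤ, (e = 1 ∨ e = -1) ∧ y = e * |y| := fun y => by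
    rcases abs_cases y with h | h
    · exact ⟨1, by simp, by omega⟩
    · exact ⟨-1, by simp, by omega⟩
  have habs : ∀ {y : ℤ}, y = 1 ∨ y = -1 → |y| = 1 := (abs_eq zero_le_one).2
  -- The sign of x₀ becomes the global sign, and the other signs are taken relative to it.
  obtain ⟨e, he, h0⟩ := hsign (x 0)
  have hrel : ∀ i, ∃ r : ℤ, (r = 1 ∨ r = -1) ∧ x i = e * r * |x i| := fun i => by
    obtain ⟨r, hr, h⟩ := hsign (x i)
    refine ⟨e * r, by rcases he with rfl | rfl <;> rcases hr with rfl | rfl <;> simp, ?_⟩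
    rw [show e * (e * r) = r by rcases he with rfl | rfl <;> ring]
    exact h
  obtain ⟨r1, hr1, h1⟩ := hrel 1
  obtain ⟨r2, hr2, h2⟩ := hrel 2
  obtain ⟨r3, hr3, h3⟩ := hrel 3
  obtain ⟨r4, hr4, h4⟩ := hrel 4
  have key : ∀ T : CoverTree, T.covers [1, r1, r2, r3, r4] = true →
      ∃ c, ∑ i, |x i - relationVec a c i| ≤ 5 * a + 4 := fun T hT => by
    refine CoverTree.exists_relationVec_of_signs (s := ![1, r1, r2, r3, r4]) hT ?_ ha (habs he) ?_
      hsum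
    · simp [Fin.forall_fin_succ, habs hr1, habs hr2, habs hr3, habs hr4]
    · rw [Fin.forall_fin_succ, Fin.forall_fin_succ, Fin.forall_fin_succ, Fin.forall_fin_succ,
        Fin.forall_fin_one]
      exact ⟨by simpa using h0, h1, h2, h3, h4⟩
  rcases hr1 with rfl | rfl <;> rcases hr2 with rfl | rfl <;> rcases hr3 with rfl | rfl <;>
    rcases hr4 with rfl | rfl
  · exact key _ coverTreePPPP_covers
  · exact key _ coverTreePPPM_covers
  · exact key _ coverTreePPMP_covers
  · exact key _ coverTreePPMM_covers
  · exact key _ coverTreePMPP_covers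
  · exact key _ coverTreePMPM_covers
  · exact key _ coverTreePMMP_covers
  · exact key _ coverTreePMMM_covers
  · exact key _ coverTreeMPPP_covers
  · exact key _ coverTreeMPPM_covers
  · exact key _ coverTreeMPMP_covers
  · exact key _ coverTreeMPMM_covers
  · exact key _ coverTreeMMPP_covers
  · exact key _ coverTreeMMPM_covers
  · exact key _ coverTreeMMMP_covers
  · exact key _ coverTreeMMMM_covers

/-! ### Distinctness of the generators and degree 10 -/

theorem circGen_strictMono (a : ℕ) : StrictMono (circGen a) := by
  rw [Fin.strictMono_iff_lt_succ]
  -- The coefficients of each power grow weakly from one generator to the next, so the powers may be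
  -- treated as independent natural numbers.
  generalize h2 : a ^ 2 = p
  generalize h3 : a ^ 3 = q
  generalize h4 : a ^ 4 = r
  intro i
  fin_cases i <;> simp [circGen, h2, h3, h4] <;> omega

theorem circGen_pos (a : ℕ) (i : Fin 5) : 0 < circGen a i :=
  lt_of_lt_of_le Nat.one_pos ((circGen_strictMono a).monotone (Fin.zero_le i))

/-- Positive numbers below n/2 that are distinct give, with their negatives, ten distinct nonzero
residues; this is what yields degree 10. -/
theorem two_mul_circGen_lt (a : ℕ) (i : Fin 5) : 2 * circGen a i < circOrder a := by
  refine lt_of_le_of_lt (Nat.mul_le_mul_left 2 ((circGen_strictMono a).monotone (Fin.le_last i))) ?_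
  change 2 * (220 + 850 * a + 1272 * a ^ 2 + 896 * a ^ 3 + 256 * a ^ 4) < _
  unfold circOrder
  generalize a ^ 2 = p
  generalize a ^ 3 = q
  generalize a ^ 4 = r
  generalize a ^ 5 = s
  omega

/-- The generating set of the circulant graph, in `ZMod n`. -/
def circSet (a : ℕ) : Set (ZMod (circOrder a)) :=
  Set.range fun i => (circGen a i : ZMod (circOrder a))

/-- The generators and their negatives. -/
def signedGen (a : ℕ) : Fin 5 ⊕ Fin 5 → ZMod (circOrder a) :=
  Sum.elim (fun i => circGen a i) (fun i => -circGen a i)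

theorem signedGen_injective (a : ℕ) : Function.Injective (signedGen a) := by
  have hinj : Function.Injective fun i => (circGen a i : ZMod (circOrder a)) := by
    intro i j h
    apply (circGen_strictMono a).injective
    have hi := two_mul_circGen_lt a i
    have hj := two_mul_circGen_lt a j
    have := (ZMod.natCast_eq_natCast_iff' _ _ _).1 h
    rwa [Nat.mod_eq_of_lt (by omega), Nat.mod_eq_of_lt (by omega)] at this
  refine hinj.sumElim (neg_injective.comp hinj) fun i j h => ?_
  have hi := two_mul_circGen_lt a i
  have hj := two_mul_circGen_lt a j
  have h0 : ((circGen a i + circGen a j : ℕ) : ZMod (circOrder a)) = 0 := by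
    rw [Nat.cast_add, h, neg_add_cancel]
  have := Nat.eq_zero_of_dvd_of_lt ((ZMod.natCast_eq_zero_iff _ _).1 h0) (by omega)
  have := circGen_pos a i
  omega

theorem mem_range_signedGen {a : ℕ} {x : ZMod (circOrder a)} :
    x ∈ Set.range (signedGen a) ↔ x ∈ circSet a ∨ -x ∈ circSet a := by
  simp only [signedGen, Set.Sum.elim_range, circSet, Set.mem_union, Set.mem_range,
    neg_eq_iff_eq_neg]

theorem ncard_circSet (a : ℕ) : (circSet a).ncard = 5 := by
  rw [circSet, Set.ncard_range_of_injective, Nat.card_eq_fintype_card, Fintype.card_fin]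
  exact (signedGen_injective a).comp Sum.inl_injective

theorem ncard_neighborSet (a : ℕ) (v : ZMod (circOrder a)) :
    ((SimpleGraph.circulantGraph (circSet a)).neighborSet v).ncard = 10 := by
  have h : (SimpleGraph.circulantGraph (circSet a)).neighborSet v =
      Set.range fun i => v + signedGen a i := by
    ext w
    have hr : (∃ i, v + signedGen a i = w) ↔ w - v ∈ Set.range (signedGen a) :=
      exists_congr fun i => by rw [eq_sub_iff_add_eq, add_comm]
    rw [SimpleGraph.mem_neighborSet, SimpleGraph.circulantGraph_adj, Set.mem_range, hr,
      mem_range_signedGen, neg_sub, or_comm]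
    refine and_iff_right_of_imp ?_
    rintro h rfl
    rw [sub_self, or_self, circSet, Set.mem_range] at h
    obtain ⟨i, hi⟩ := h
    have hlt := two_mul_circGen_lt a i
    have := Nat.eq_zero_of_dvd_of_lt ((ZMod.natCast_eq_zero_iff _ _).1 hi) (by omega)
    exact (circGen_pos a i).ne' this
  rw [h]
  refine (Set.ncard_range_of_injective
    ((add_right_injective v).comp (signedGen_injective a))).trans ?_
  rw [Nat.card_eq_fintype_card]
  rfl

theorem one_mem_circSet (a : ℕ) : 1 ∈ circSet a := ⟨0, by simp [circGen]⟩

theorem closure_circSet (a : ℕ) : AddSubgroup.closure (circSet a) = ⊤ := by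
  refine eq_top_iff.2 fun x _ => ?_
  obtain ⟨m, rfl⟩ := ZMod.intCast_surjective x
  rw [← zsmul_one]
  exact zsmul_mem (AddSubgroup.subset_closure (one_mem_circSet a)) m

/-! ### The diameter as a covering radius -/

theorem sum_zsmul_circGen (a : ℕ) (y : Fin 5 → ℤ) :
    ∑ i, y i • (circGen a i : ZMod (circOrder a)) =
      ((∑ i, y i * (circGen a i : ℤ) : ℤ) : ZMod (circOrder a)) := by
  push_cast
  simp only [zsmul_eq_mul]

theorem mem_wordBall_circSet_iff {a d : ℕ} {x : ZMod (circOrder a)} :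
    x ∈ wordBall (circSet a) d ↔
      ∃ y : Fin 5 → ℤ, ∑ i, |y i| ≤ d ∧ ((∑ i, y i * (circGen a i : ℤ) : ℤ) : ZMod _) = x := by
  simp only [circSet, mem_wordBall_range_iff, sum_zsmul_circGen]

/-- Only words of norm exactly 5a + 5 need shortening: subtracting a relation keeps the residue, so
the ball of radius 5a + 5 is no larger than that of radius 5a + 4. Every residue lies in some ball
because 1 is a generator. -/
theorem mem_wordBall_circSet {a : ℕ} (ha : 2 ≤ a) (x : ZMod (circOrder a)) :
    x ∈ wordBall (circSet a) (5 * a + 4) := by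
  have hsub : wordBall (circSet a) (5 * a + 4 + 1) ⊆ wordBall (circSet a) (5 * a + 4) := by
    intro x hx
    rw [mem_wordBall_circSet_iff] at hx ⊢
    obtain ⟨y, hy, hyx⟩ := hx
    rcases hy.lt_or_eq with hlt | heq
    · exact ⟨y, by push_cast at *; omega, hyx⟩
    · obtain ⟨c, hc⟩ := exists_relationVec_near (a := a) (by omega) (x := y)
        (by rw [heq]; push_cast; ring)
      refine ⟨fun i => y i - relationVec a c i, by push_cast; exact hc, ?_⟩
      simp only [sub_mul, Finset.sum_sub_distrib, sum_relationVec_mul_circGen]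
      push_cast at hyx ⊢
      simp [hyx]
  have hn : circOrder a ≠ 0 := by unfold circOrder; omega
  have : NeZero (circOrder a) := ⟨hn⟩
  rw [← ZMod.natCast_zmod_val x]
  exact wordBall_subset_of_succ_subset hsub _ (natCast_mem_wordBall (one_mem_circSet a) _)

/-- A word y of norm at most 5a + 3 for the residue of the centre would make `centerVec a - y` a
relation at distance |y| from the centre. -/
theorem exists_notMem_wordBall_circSet {a : ℕ} (ha : 2 ≤ a) :
    ∃ x, x ∉ wordBall (circSet a) (5 * a + 3) := by
  refine ⟨((∑ i, centerVec a i * (circGen a i : ℤ) : ℤ) : ZMod _), fun h => ?_⟩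
  obtain ⟨y, hy, hyx⟩ := mem_wordBall_circSet_iff.1 h
  rw [ZMod.intCast_eq_intCast_iff_dvd_sub, ← Finset.sum_sub_distrib] at hyx
  simp only [← sub_mul] at hyx
  obtain ⟨c, hc⟩ := exists_eq_relationVec (z := fun i => centerVec a i - y i) hyx
  have := le_dist_centerVec (a := a) (by omega) c
  rw [← hc] at this
  simp only [sub_sub_cancel] at this
  push_cast at hy
  omega

/-- Computation of the diameter with bit vectors. -/
theorem ediam_circSet_of_ballBits {a d : ℕ}
    (h : ballBits (circOrder a) (List.ofFn (circGen a) ++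
      List.ofFn fun i => circOrder a - circGen a i) (d + 1) = 2 ^ circOrder a - 1)
    (h' : ballBits (circOrder a) (List.ofFn (circGen a) ++
      List.ofFn fun i => circOrder a - circGen a i) d ≠ 2 ^ circOrder a - 1) :
    (SimpleGraph.circulantGraph (circSet a)).ediam = (d + 1 : ℕ) := by
  have hle : ∀ i, circGen a i ≤ circOrder a := fun i => by
    have := two_mul_circGen_lt a i
    omega
  refine ediam_eq_of_ballBits (by unfold circOrder; omega) ?_ (fun s => ?_) h h'
  · intro g hg
    rw [List.mem_append, List.mem_ofFn, List.mem_ofFn] at hg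
    rcases hg with ⟨i, rfl⟩ | ⟨i, rfl⟩
    · exact hle i
    · exact Nat.sub_le _ _
  · rw [← mem_range_signedGen]
    simp only [List.mem_append, List.mem_ofFn, or_and_right, exists_or]
    rw [signedGen, Set.Sum.elim_range, Set.mem_union]
    refine or_congr ?_ ?_
    · simp
    · simp [Nat.cast_sub (hle _)]

theorem ediam_circSet (a : ℕ) :
    (SimpleGraph.circulantGraph (circSet a)).ediam = (5 * a + 4 : ℕ) := by
  rcases Nat.lt_or_ge a 2 with ha | ha
  · interval_cases a
    · exact ediam_circSet_of_ballBits (d := 3) (by decide +kernel) (by decide +kernel)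
    · exact ediam_circSet_of_ballBits (d := 8) (by decide +kernel) (by decide +kernel)
  · exact ediam_circulantGraph_eq (d := 5 * a + 3) (mem_wordBall_circSet ha)
      (exists_notMem_wordBall_circSet ha)

/-- For every `k ≡ 4 (mod 5)` the numbers `n, g₂, g₃, g₄, g₅` given by the displayed formulae are
natural numbers, and the circulant graph on the cyclic group `ZMod n` (so of order `n`) with
generating set `S = {1, g₂, g₃, g₄, g₅}` (two vertices are adjacent iff they differ by an element
of `S ∪ -S`) is a Cayley graph on five generators, regular of degree 10, with diameter exactly
`k`. The value of `ediam` is finite only for connected graphs of bounded distance. -/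
theorem theorem9 (k : ℕ) (hk : k ≡ 4 [MOD 5]) :
    ∃ n g₂ g₃ g₄ g₅ : ℕ,
      (n : ℚ) = (512 * (k : ℚ) ^ 5 + 1280 * (k : ℚ) ^ 4 + 6400 * (k : ℚ) ^ 3
        + 8640 * (k : ℚ) ^ 2 + 6890 * (k : ℚ) + 757) / 3125 ∧
      (g₂ : ℚ) = (32 * (k : ℚ) ^ 3 + 56 * (k : ℚ) ^ 2 + 316 * (k : ℚ) + 167) / 125 ∧
      (g₃ : ℚ) = (128 * (k : ℚ) ^ 4 + 192 * (k : ℚ) ^ 3 + 1408 * (k : ℚ) ^ 2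
        + 1002 * (k : ℚ) + 908) / 625 ∧
      (g₄ : ℚ) = (128 * (k : ℚ) ^ 4 + 352 * (k : ℚ) ^ 3 + 1488 * (k : ℚ) ^ 2
        + 2432 * (k : ℚ) + 543) / 625 ∧
      (g₅ : ℚ) = (256 * (k : ℚ) ^ 4 + 384 * (k : ℚ) ^ 3 + 2616 * (k : ℚ) ^ 2
        + 1354 * (k : ℚ) + 116) / 625 ∧
      ∀ S : Set (ZMod n), S = {1, (g₂ : ZMod n), (g₃ : ZMod n), (g₄ : ZMod n), (g₅ : ZMod n)} →
        S.ncard = 5 ∧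
        AddSubgroup.closure S = ⊤ ∧
        (∀ v : ZMod n, ((SimpleGraph.circulantGraph S).neighborSet v).ncard = 10) ∧
        (SimpleGraph.circulantGraph S).ediam = (k : ℕ∞) := by
  obtain ⟨a, rfl⟩ : ∃ a, k = 5 * a + 4 := ⟨k / 5, by rw [Nat.ModEq] at hk; omega⟩
  refine ⟨circOrder a, circGen a 1, circGen a 2, circGen a 3, circGen a 4, ?_, ?_, ?_, ?_, ?_, ?_⟩
  · simp only [circOrder]
    push_cast
    ring
  · simp only [circGen, Matrix.cons_val]
    push_cast
    ring
  · simp only [circGen, Matrix.cons_val]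
    push_cast
    ring
  · simp only [circGen, Matrix.cons_val]
    push_cast
    ring
  · simp only [circGen, Matrix.cons_val]
    push_cast
    ring
  · intro S hS
    have h : S = circSet a := by
      rw [hS]
      ext x
      simp only [circSet, Set.mem_range, Fin.exists_fin_succ, Set.mem_insert_iff,
        Set.mem_singleton_iff, eq_comm (b := x)]
      simp [circGen]
    rw [h]
    exact ⟨ncard_circSet a, closure_circSet a, ncard_neighborSet a, ediam_circSet a⟩
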